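/- Let $m,\beta>0$ and let $K$ be a memory kernel on $\mathbb R$, real-valued for $t\neq0$ (its value at $t=0$ is immaterial and may be infinite). For functions and tempered distributions use the Fourier transform $\widehat\varphi(\omega)=\mathcal F[\varphi](\omega)=\int_{\mathbb R}e^{-i\omega t}\varphi(t)\,dt$, the integral being understood as the improper integral $\lim_{T\to\infty}\int_{-T}^{T}$ for $K$ and for $K^+(t):=K(t)1_{\{t\ge 0\}}$; write $\widetilde f(t)=f(-t)$. Assume: (I) (a) $K\in L^1_{loc}(\mathbb R)$ is even, and $K(t)>0$ for all $t\ne0$; (b) $K(t)\to0$ as $t\to\infty$ and $K$ is eventually decreasing; (c) the improper integral $\mathcal K_{\cos}(\omega)=\int_0^\infty K(t)\cos(\omega t)\,dt$ is positive for every $\omega\neq0$. (II) $K(t)\sim t^{-1}$ as $t\to\infty$, that is, $tK(t)\to c$ for some $c\in(0,\infty)$. Consider the generalized Langevin equation $$m\,\dot V(t)=-\beta\int_{-\infty}^tK(t-s)V(s)\,ds+\sqrt\beta\,F(t),$$ where the force $F:\mathcal S\to L^2(\Omega')$ is the centred Gaussian stationary random distribution on the space $\mathcal S$ of complex Schwartz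 functions on $\mathbb R$ with $$\mathbb E\big[\langle F,\varphi_1\rangle\overline{\langle F,\varphi_2\rangle}\big]=\int_{\mathbb R}K(t)\,\big(\varphi_1*\widetilde{\overline{\varphi_2}}\big)(t)\,dt .$$ Let $\nu$ be a non-negative Borel measure on $\mathbb R$, absolutely continuous with respect to Lebesgue measure, with $\int_{\mathbb R}(1+x^2)^{-k}\,\nu(dx)<\infty$ for some integer $k$. Let $\mathrm{Dom}(V)$ be the space of tempered distributions $g$ such that $\mathcal F[g]$ is a function in $L^2(\nu)$, and let $V:\mathrm{Dom}(V)\to L^2(\Omega)$ be the centred complex Gaussian linear operator with spectral measure $\nu$, i.e. $$\mathbb E\big[\langle V,g_1\rangle\overline{\langle V,g_2\rangle}\big]=\int_{\mathbb R}\mathcal F[g_1](\omega)\,\overline{\mathcal F[g_2](\omega)}\,\nu(d\omega).$$ $V$ is called a *weak solution* if (a) $K^+*\varphi\in\mathrm{Dom}(V)$ for every $\varphi\in\mathcal S$, and (b) for all $\varphi,\psi\in\mathcal S$, $$\mathbb E\Big[\big\langle V,-m\varphi'+\beta\,\widetilde{K^+*\widetilde\varphi}\,\big\rangle\,\overline{\big\langle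 V,-m\psi'+\beta\,\widetilde{K^+*\widetilde\psi}\,\big\rangle}\Big]=\mathbb E\Big[\langle\sqrt\beta F,\varphi\rangle\,\overline{\langle\sqrt\beta F,\psi\rangle}\Big]$$ (the arguments of $V$ being in $\mathrm{Dom}(V)$). **Theorem.** Assume (I) and (II). For every $\omega\ne0$ the improper integrals $\widehat K(\omega)$ and $\widehat{K^+}(\omega)$ converge, and the function $$\widehat r(\omega)=\frac{\beta\,\widehat K(\omega)}{2\pi\,\big|mi\omega+\beta\,\widehat{K^+}(\omega)\big|^2}$$ is integrable on $\mathbb R$. Moreover, $V$ is a weak solution of the generalized Langevin equation if and only if its spectral measure is $\nu(d\omega)=\widehat r(\omega)\,d\omega$. -/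

import Mathlib

open MeasureTheory Filter Topology
open scoped SchwartzMap FourierTransform ComplexConjugate

noncomputable section

namespace GLE

/-! ## Improper integrals and the memory kernel -/

/-- The cosine transform `K_cos(ω) = ∫₀^∞ K(t) cos(ωt) dt`, an improper integral. -/
def Kcos (K : ℝ → ℝ) (ω : ℝ) : ℝ :=
  limUnder atTop fun T : ℝ => ∫ t in (0 : ℝ)..T, K t * Real.cos (ω * t)

/-- The truncated Fourier integral `∫_{-T}^T e^{-iωt} f(t) dt`. -/
def truncFourier (f : ℝ → ℝ) (ω T : ℝ) : ℂ :=
  ∫ t in (-T)..T, Complex.exp (-(Complex.I * ω * t)) * (f t : ℂ)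

/-- The Fourier transform `f̂(ω) = ∫_ℝ e^{-iωt} f(t) dt` of a function, as an improper integral. -/
def improperFourier (f : ℝ → ℝ) (ω : ℝ) : ℂ :=
  limUnder atTop (truncFourier f ω)

/-- `K⁺(t) = K(t) 1_{t ≥ 0}`. -/
def Kplus (K : ℝ → ℝ) : ℝ → ℝ := Set.indicator (Set.Ici 0) K

/-- Condition (I) on the memory kernel. Nothing is imposed on the value of `K` at `0`, which plays
no role anywhere. -/
structure CondI (K : ℝ → ℝ) : Prop where
  locallyIntegrable : LocallyIntegrable K volume
  even : ∀ t, K (-t) = K t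
  pos : ∀ t, t ≠ 0 → 0 < K t
  tendsto_zero : Tendsto K atTop (𝓝 0)
  eventually_antitone : ∃ A, AntitoneOn K (Set.Ici A)
  Kcos_pos : ∀ ω, ω ≠ 0 → 0 < Kcos K ω

/-- Condition (II): `K(t) ∼ t⁻¹`, where `f ∼ g` means that `f / g` tends to a finite positive
constant. -/
def CondII (K : ℝ → ℝ) : Prop :=
  ∃ c : ℝ, 0 < c ∧ Tendsto (fun t => t * K t) atTop (𝓝 c)

/-- The spectral density `r̂(ω) = β K̂(ω) / (2π |m i ω + β K̂⁺(ω)|²)`. As `K` is even, `K̂` is real;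
the real part only serves to read it as a real number. -/
def spectralDensity (m β : ℝ) (K : ℝ → ℝ) (ω : ℝ) : ℝ :=
  β * (improperFourier K ω).re /
    (2 * Real.pi * ‖(m : ℂ) * Complex.I * ω + β * improperFourier (Kplus K) ω‖ ^ 2)

/-! ## The Fourier transform of tempered distributions, with kernel `e^{-iωt}` -/

/-- The scaling `ω ↦ ω / (2π)`. -/
def scale : ℝ ≃L[ℝ] ℝ :=
  ContinuousLinearEquiv.unitsEquivAut ℝ (Units.mk0 (2 * Real.pi)⁻¹ (by positivity))

/-- The Fourier transform on Schwartz functions, `φ̂(ω) = ∫ e^{-iωt} φ(t) dt`. -/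
def fourierS (φ : 𝓢(ℝ, ℂ)) : 𝓢(ℝ, ℂ) :=
  SchwartzMap.compCLMOfContinuousLinearEquiv ℂ scale (𝓕 φ)

theorem fourierS_apply (φ : 𝓢(ℝ, ℂ)) (ω : ℝ) :
    fourierS φ ω = ∫ t : ℝ, Complex.exp (-(Complex.I * ω * t)) * φ t := by
  have h : fourierS φ ω = (𝓕 (φ : ℝ → ℂ)) (scale ω) := by
    simp [fourierS, SchwartzMap.fourier_coe]
  rw [h, Real.fourier_real_eq_integral_exp_smul]
  refine integral_congr_ae (Eventually.of_forall fun t => ?_)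
  have hs : scale ω = ω * (2 * Real.pi)⁻¹ := by
    simp [scale]
  simp only [smul_eq_mul, hs]
  congr 2
  push_cast
  have hpi : (Real.pi : ℂ) ≠ 0 := by exact_mod_cast Real.pi_ne_zero
  field_simp

/-- The Fourier transform `F[g]` of the tempered distribution `g`, given by `F[g](φ) = g(φ̂)`, is
the (locally integrable) function `f`. -/
def FourierIsFun (g : 𝓢'(ℝ, ℂ)) (f : ℝ → ℂ) : Prop :=
  LocallyIntegrable f volume ∧
    ∀ φ : 𝓢(ℝ, ℂ), HasCompactSupport φ → g (fourierS φ) = ∫ ω, f ω * φ ω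

/-- The function `h`, regarded as a tempered distribution, is `g`: `g(φ) = ∫ h φ` for all `φ`,
with absolutely convergent integrals. -/
def IsRegular (g : 𝓢'(ℝ, ℂ)) (h : ℝ → ℂ) : Prop :=
  ∀ φ : 𝓢(ℝ, ℂ), Integrable (fun t => h t * φ t) volume ∧ g φ = ∫ t, h t * φ t

theorem integrable_mul_compactSupport {f : ℝ → ℂ} (hf : LocallyIntegrable f volume)
    (φ : 𝓢(ℝ, ℂ)) (hφ : HasCompactSupport φ) : Integrable (fun ω => f ω * φ ω) volume := by
  have := hf.integrable_smul_left_of_hasCompactSupport φ.continuous hφ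
  simpa [mul_comm] using this

theorem FourierIsFun.add {g₁ g₂ : 𝓢'(ℝ, ℂ)} {f₁ f₂ : ℝ → ℂ}
    (h₁ : FourierIsFun g₁ f₁) (h₂ : FourierIsFun g₂ f₂) :
    FourierIsFun (g₁ + g₂) (f₁ + f₂) := by
  refine ⟨h₁.1.add h₂.1, fun φ hφ => ?_⟩
  have e : (g₁ + g₂) (fourierS φ) = g₁ (fourierS φ) + g₂ (fourierS φ) := rfl
  rw [e, h₁.2 φ hφ, h₂.2 φ hφ, ← integral_add (integrable_mul_compactSupport h₁.1 φ hφ)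
    (integrable_mul_compactSupport h₂.1 φ hφ)]
  simp [add_mul]

theorem FourierIsFun.smul {g : 𝓢'(ℝ, ℂ)} {f : ℝ → ℂ} (c : ℂ) (h : FourierIsFun g f) :
    FourierIsFun (c • g) (c • f) := by
  refine ⟨h.1.smul c, fun φ hφ => ?_⟩
  have e : (c • g) (fourierS φ) = c * g (fourierS φ) := rfl
  rw [e, h.2 φ hφ, ← integral_const_mul]
  simp [mul_assoc]

theorem FourierIsFun.zero : FourierIsFun (0 : 𝓢'(ℝ, ℂ)) (0 : ℝ → ℂ) := by
  refine ⟨locallyIntegrable_const 0, fun φ _ => ?_⟩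
  have e : (0 : 𝓢'(ℝ, ℂ)) (fourierS φ) = 0 := rfl
  simp [e]

/-! ## Spectral measures, stationary random distributions, weak solutions -/

/-- `∫ ν(dx) / (1 + x²)^k < ∞` for some integer `k`. -/
def IsTempered (ν : Measure ℝ) : Prop :=
  ∃ k : ℕ, ∫⁻ x, ENNReal.ofReal ((1 + x ^ 2) ^ k)⁻¹ ∂ν < ⊤

/-- `Dom(V)`: the tempered distributions whose Fourier transform is a function in `L²(ν)`. -/
def Dom (ν : Measure ℝ) : Submodule ℂ 𝓢'(ℝ, ℂ) where
  carrier := {g | ∃ f : ℝ → ℂ, FourierIsFun g f ∧ MemLp f 2 ν}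
  add_mem' := by
    rintro g₁ g₂ ⟨f₁, h₁, m₁⟩ ⟨f₂, h₂, m₂⟩
    exact ⟨f₁ + f₂, h₁.add h₂, m₁.add m₂⟩
  zero_mem' := ⟨0, FourierIsFun.zero, MemLp.zero⟩
  smul_mem' := by
    rintro c g ⟨f, h, m⟩
    exact ⟨c • f, h.smul c, m.const_smul c⟩

/-- The operator `V : Dom(V) → L²(Ω)` associated with the spectral measure `ν`: centred, complex
Gaussian, with `E[⟨V,g₁⟩ conj ⟨V,g₂⟩] = ∫ F[g₁] conj F[g₂] dν`. It is meant for `ν` absolutely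
continuous with respect to Lebesgue measure, so that the right-hand side does not depend on the
choice of the functions representing `F[g₁]` and `F[g₂]`. -/
structure SpectralOperator {Ω : Type*} [MeasurableSpace Ω] (P : Measure Ω) (ν : Measure ℝ) where
  toLin : Dom ν →ₗ[ℂ] Lp ℂ 2 P
  gaussian : ∀ g, ProbabilityTheory.HasGaussianLaw (toLin g : Ω → ℂ) P
  centered : ∀ g, ∫ ω, (toLin g : Ω → ℂ) ω ∂P = 0
  covariance : ∀ (g₁ g₂ : Dom ν) (f₁ f₂ : ℝ → ℂ), FourierIsFun g₁ f₁ → FourierIsFun g₂ f₂ →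
    ∫ ω, (toLin g₁ : Ω → ℂ) ω * conj ((toLin g₂ : Ω → ℂ) ω) ∂P = ∫ x, f₁ x * conj (f₂ x) ∂ν

/-- The convolution `(f * g)(t) = ∫ f(u) g(t - u) du` of complex functions on `ℝ`. -/
def conv (f g : ℝ → ℂ) : ℝ → ℂ :=
  MeasureTheory.convolution f g (ContinuousLinearMap.mul ℝ ℂ) volume

/-- The force `F`: a stationary random distribution, centred and complex Gaussian, with
`E[⟨F,φ₁⟩ conj ⟨F,φ₂⟩] = ∫ K(t) (φ₁ * φ₂^*)(t) dt`, where `φ₂^*(t) = conj φ₂(-t)`. This is the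
weak form of `E[F(t) F(s)] = K(t - s)`. -/
structure StationaryForce {Ω : Type*} [MeasurableSpace Ω] (P : Measure Ω) (K : ℝ → ℝ) where
  toLin : 𝓢(ℝ, ℂ) →ₗ[ℂ] Lp ℂ 2 P
  gaussian : ∀ φ, ProbabilityTheory.HasGaussianLaw (toLin φ : Ω → ℂ) P
  centered : ∀ φ, ∫ ω, (toLin φ : Ω → ℂ) ω ∂P = 0
  covariance : ∀ φ₁ φ₂ : 𝓢(ℝ, ℂ),
    ∫ ω, (toLin φ₁ : Ω → ℂ) ω * conj ((toLin φ₂ : Ω → ℂ) ω) ∂P =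
      ∫ t, (K t : ℂ) * conv φ₁ (fun s => conj (φ₂ (-s))) t

/-- The reflection `f~(t) = f(-t)`. -/
def reflect (f : ℝ → ℂ) : ℝ → ℂ := fun t => f (-t)

/-- `K⁺ * φ`. -/
def KplusConv (K : ℝ → ℝ) (φ : ℝ → ℂ) : ℝ → ℂ :=
  conv (fun t => (Kplus K t : ℂ)) φ

/-- The function `-m φ' + β (K⁺ * φ~)~` to which `V` is applied in the weak form of the GLE. -/
def weakTest (m β : ℝ) (K : ℝ → ℝ) (φ : 𝓢(ℝ, ℂ)) : ℝ → ℂ := fun t =>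
  -(m : ℂ) * deriv φ t + β * reflect (KplusConv K (reflect φ)) t

/-- `V` is a weak solution of `m V'(t) = -β ∫_{-∞}^t K(t-s) V(s) ds + √β F(t)`. -/
def IsWeakSolution {Ω Ω' : Type*} [MeasurableSpace Ω] [MeasurableSpace Ω']
    {P : Measure Ω} {P' : Measure Ω'} {ν : Measure ℝ} {K : ℝ → ℝ} (m β : ℝ)
    (V : SpectralOperator P ν) (F : StationaryForce P' K) : Prop :=
  (∀ φ : 𝓢(ℝ, ℂ), ∃ g : Dom ν, IsRegular g (KplusConv K φ)) ∧
  (∀ φ ψ : 𝓢(ℝ, ℂ), ∃ g₁ g₂ : Dom ν,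
    IsRegular g₁ (weakTest m β K φ) ∧ IsRegular g₂ (weakTest m β K ψ) ∧
    ∫ ω, (V.toLin g₁ : Ω → ℂ) ω * conj ((V.toLin g₂ : Ω → ℂ) ω) ∂P =
      ∫ ω, ((√β : ℝ) * (F.toLin φ : Ω' → ℂ) ω) * conj ((√β : ℝ) * (F.toLin ψ : Ω' → ℂ) ω) ∂P')

end GLE

end

/-!
The equation is diagonal in frequency. Let `H(ω) = ∫₀^∞ e^{-iωt} K(t) dt` (`halfTransform`). Then
`K̂⁺ = H`, the reflected causal kernel has transform `conj H`, and `K̂ = 2 Re H = 2 K_cos`. With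
`p(ω) = m i ω + β H(ω)` (`symbol`), the Fourier transform of the tested function
`-m φ' + β (K⁺ * φ~)~` is `conj p · φ̂`, so the weak equation reads
`∫ |p|² φ̂ conj ψ̂ dν = (β / π) ∫ Re H · φ̂ conj ψ̂ dω`, for all Schwartz `φ, ψ`.
Since the Fourier transform is onto the Schwartz functions, this says `|p|² ν = (β / π) Re H dω`,
and dividing by `|p|²`, which does not vanish off `0`, gives `ν = r̂ dω`.

Three analytic facts make this rigorous.

* The kernel decreases like `1 / t`, so its improper transforms converge, and their truncations
  stay below `D (1 + |ω|^{-1/4})` uniformly (`KernelTail.norm_integral_le`,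
  `KernelTail.exists_norm_halfTrunc_le`). This majorant is integrable against Schwartz functions,
  even when squared, hence Parseval's formula survives the passage from truncated kernels to `K`,
  `K⁺` and its reflection (`TameKernel.integral_mul_fourierS`), and the transform of `K⁺ * φ`
  is the function `H φ̂` (`TameKernel.exists_isRegular_conv`).
* `Re H` is positive and continuous off `0`, and tends to infinity at `0` because `∫ K` diverges,
  while `m i ω` dominates at high frequency; hence `0 ≤ r̂ ≤ M / (1 + ω²)`
  (`KernelTail.exists_spectralDensity_le`). This gives integrability of `r̂`, and the membership of
  `K⁺ * φ` in the domain when `ν = r̂ dω`.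
* A locally integrable function is determined by its pairings with products of Schwartz functions
  (`ae_eq_of_forall_integral_mul_conj_eq`). A tempered measure is locally finite, so `ν` has a
  density, and the weak equation identifies it.
-/

noncomputable section

namespace GLE

/-! ### Oscillatory integrals of an eventually decreasing kernel -/

/-- The oscillating factor `e^{-iωt}`. -/
def osc (ω t : ℝ) : ℂ := Complex.exp (-(Complex.I * ω * t))

theorem osc_continuous (ω : ℝ) : Continuous (osc ω) := by
  unfold osc; fun_prop

theorem osc_continuous_left (t : ℝ) : Continuous fun ω => osc ω t := by
  unfold osc; fun_prop

@[simp] theorem norm_osc (ω t : ℝ) : ‖osc ω t‖ = 1 := by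
  have : -(Complex.I * ω * t) = ((-(ω * t) : ℝ) : ℂ) * Complex.I := by push_cast; ring
  rw [osc, this, Complex.norm_exp_ofReal_mul_I]

theorem osc_eq (ω t : ℝ) : osc ω t = Real.cos (ω * t) - Real.sin (ω * t) * Complex.I := by
  have : -(Complex.I * ω * t) = (-(ω * t : ℝ) : ℂ) * Complex.I := by push_cast; ring
  rw [osc, this, Complex.exp_mul_I]
  simp only [Complex.cos_neg, Complex.sin_neg, ← Complex.ofReal_cos, ← Complex.ofReal_sin]
  ring

theorem osc_neg (ω t : ℝ) : osc (-ω) t = conj (osc ω t) := by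
  rw [osc, osc, ← Complex.exp_conj]
  simp

theorem osc_neg' (ω t : ℝ) : osc ω (-t) = conj (osc ω t) := by
  rw [osc, osc, ← Complex.exp_conj]
  simp

theorem osc_add (ω s t : ℝ) : osc ω (s + t) = osc ω s * osc ω t := by
  rw [osc, osc, osc, ← Complex.exp_add]; push_cast; ring_nf

/-- Shifting by half a period changes the sign of the oscillating factor. -/
theorem osc_sub_half_period {ω : ℝ} (hω : ω ≠ 0) (t : ℝ) :
    osc ω (t - Real.pi / |ω|) = -osc ω t := by
  rw [osc_eq, osc_eq]
  rcases abs_cases ω with ⟨h, _⟩ | ⟨h, _⟩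
  · have e : ω * (t - Real.pi / |ω|) = ω * t - Real.pi := by rw [h]; field_simp
    rw [e, Real.cos_sub_pi, Real.sin_sub_pi]; push_cast; ring
  · have e : ω * (t - Real.pi / |ω|) = ω * t + Real.pi := by rw [h]; field_simp; ring
    rw [e, Real.cos_add_pi, Real.sin_add_pi]; push_cast; ring

theorem _root_.MeasureTheory.LocallyIntegrable.intervalIntegrable_real {E : Type*}
    [NormedAddCommGroup E] {f : ℝ → E} (hf : LocallyIntegrable f volume) (a b : ℝ) :
    IntervalIntegrable f volume a b :=
  (hf.integrableOn_isCompact isCompact_uIcc).intervalIntegrable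

/-- The truncated one-sided transform `∫_0^T e^{-iωt} K(t) dt`. -/
def halfTrunc (K : ℝ → ℝ) (ω T : ℝ) : ℂ := ∫ t in (0 : ℝ)..T, osc ω t * (K t : ℂ)

theorem osc_mul_intervalIntegrable {K : ℝ → ℝ} (hK : LocallyIntegrable K volume)
    (ω a b : ℝ) : IntervalIntegrable (fun t => osc ω t * (K t : ℂ)) volume a b := by
  have : IntervalIntegrable (fun t => (K t : ℂ)) volume a b := by
    have := hK.intervalIntegrable_real a b
    exact ⟨this.1.ofReal, this.2.ofReal⟩
  exact this.continuousOn_mul (osc_continuous ω).continuousOn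

/-- The kernel is locally integrable, nonnegative on the positive half-line and, on `[A, ∞)` with
`A ≥ 1`, decreasing and at most `C / t`. -/
structure KernelTail (K : ℝ → ℝ) (A C : ℝ) : Prop where
  locallyIntegrable : LocallyIntegrable K volume
  one_le : 1 ≤ A
  C_pos : 0 < C
  anti : AntitoneOn K (Set.Ici A)
  nonneg : ∀ t, 0 < t → 0 ≤ K t
  le : ∀ t, A ≤ t → K t ≤ C / t

/-- A decreasing kernel integrates against `e^{-iωt}` over `[S, T]` to at most a few times
`K(S) / |ω|`: averaging the integral with its shift by half a period replaces `K(t)` by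
differences `K(t - h) - K(t) ≥ 0`, whose sum telescopes. -/
theorem KernelTail.norm_integral_le {K : ℝ → ℝ} {A C : ℝ} (h : KernelTail K A C) {ω : ℝ}
    (hω : ω ≠ 0) {S T : ℝ} (hS : A ≤ S) (hST : S ≤ T) :
    ‖∫ t in S..T, osc ω t * (K t : ℂ)‖ ≤ 5 * K S / |ω| := by
  have hω' : 0 < |ω| := abs_pos.mpr hω
  have hA := h.one_le
  have hKS : 0 ≤ K S := h.nonneg S (by linarith)
  set d : ℝ := Real.pi / |ω| with hd
  have hd0 : 0 < d := by positivity
  have hle : 3 / 2 * (K S * d) ≤ 5 * K S / |ω| := by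
    have e1 : 3 / 2 * (K S * d) = (3 / 2 * Real.pi * K S) / |ω| := by rw [hd]; ring
    rw [e1]
    gcongr
    linarith [Real.pi_lt_d2]
  have hloc := h.locallyIntegrable
  have hint := osc_mul_intervalIntegrable hloc ω
  have hbd : ∀ t, S ≤ t → ‖osc ω t * (K t : ℂ)‖ ≤ K S := by
    intro t ht
    rw [norm_mul, norm_osc, one_mul, Complex.norm_real, Real.norm_eq_abs,
      abs_of_nonneg (h.nonneg t (by linarith))]
    exact h.anti hS (hS.trans ht) ht
  -- Within a single half period `d` the integral of the absolute value is small enough.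
  rcases le_or_gt T (S + d) with hT | hT
  · have h1 := intervalIntegral.norm_integral_le_of_norm_le_const (a := S) (b := T) (C := K S)
      (f := fun t => osc ω t * (K t : ℂ)) (fun t ht => by
        rw [Set.uIoc_of_le hST] at ht
        exact hbd t ht.1.le)
    rw [abs_of_nonneg (by linarith)] at h1
    have h2 : K S * (T - S) ≤ K S * d := by gcongr; linarith
    have h3 : 0 ≤ K S * d := by positivity
    linarith
  set f : ℝ → ℂ := fun t => osc ω t * (K t : ℂ) with hf
  set g : ℝ → ℂ := fun t => osc ω t * (K (t - d) : ℂ) with hg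
  have hgf : ∀ t, g t = -f (t - d) := by
    intro t
    simp only [hf, hg, hd, osc_sub_half_period hω]
    ring
  have hgint : ∀ a b, IntervalIntegrable g volume a b := by
    intro a b
    have := ((hint (a - d) (b - d)).comp_sub_right d).neg
    simp only [sub_add_cancel] at this
    exact this.congr fun t _ => (hgf t).symm
  have hgI : ∫ t in (S + d)..(T + d), g t = -∫ t in S..T, f t := by
    have := intervalIntegral.integral_comp_sub_right (a := S + d) (b := T + d) f d
    simp only [add_sub_cancel_right] at this
    rw [← this, ← intervalIntegral.integral_neg]
    exact intervalIntegral.integral_congr (fun t _ => hgf t)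
  have e1 := intervalIntegral.integral_add_adjacent_intervals (hint S (S + d)) (hint (S + d) T)
  have e2 := intervalIntegral.integral_add_adjacent_intervals (hgint (S + d) T) (hgint T (T + d))
  have e3 := intervalIntegral.integral_sub (hint (S + d) T) (hgint (S + d) T)
  -- As `g` is minus the shift of `f`, twice the integral of `f` is the integral of the
  -- difference `f - g` on the overlap, plus two boundary pieces of length `d`.
  have key : 2 * ∫ t in S..T, f t = (∫ t in S..(S + d), f t) + (∫ t in (S + d)..T, (f t - g t))
      - ∫ t in T..(T + d), g t := by
    rw [hgI] at e2
    linear_combination (-1 : ℂ) * e1 + e2 - e3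
  have b1 : ‖∫ t in S..(S + d), f t‖ ≤ K S * d := by
    have := intervalIntegral.norm_integral_le_of_norm_le_const (a := S) (b := S + d) (C := K S)
      (f := f) (fun t ht => by
        rw [Set.uIoc_of_le (by linarith)] at ht
        exact hbd t ht.1.le)
    rwa [add_sub_cancel_left, abs_of_pos hd0] at this
  have b3 : ‖∫ t in T..(T + d), g t‖ ≤ K S * d := by
    have := intervalIntegral.norm_integral_le_of_norm_le_const (a := T) (b := T + d) (C := K S)
      (f := g) (fun t ht => by
        rw [Set.uIoc_of_le (by linarith)] at ht
        rw [hgf, norm_neg]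
        exact hbd _ (by linarith [ht.1]))
    rwa [add_sub_cancel_left, abs_of_pos hd0] at this
  have hKi := hloc.intervalIntegrable_real
  -- `‖f - g‖ = K(t - d) - K(t)` by monotonicity, and the integral of this telescopes.
  have b2 : ‖∫ t in (S + d)..T, (f t - g t)‖ ≤ K S * d := by
    have hKd : IntervalIntegrable (fun t => K (t - d)) volume (S + d) T := by
      have := (hKi S (T - d)).comp_sub_right d
      simpa using this
    have h1 : ‖∫ t in (S + d)..T, (f t - g t)‖ ≤ ∫ t in (S + d)..T, (K (t - d) - K t) := by
      refine intervalIntegral.norm_integral_le_of_norm_le hT.le ?_ (hKd.sub (hKi _ _))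
      filter_upwards with t ht
      have : f t - g t = osc ω t * ((K t - K (t - d) : ℝ) : ℂ) := by
        simp only [hf, hg]; push_cast; ring
      rw [this, norm_mul, norm_osc, one_mul, Complex.norm_real, Real.norm_eq_abs, abs_sub_comm,
        abs_of_nonneg]
      have h5 : A ≤ t - d := by linarith [ht.1]
      have h6 : A ≤ t := by linarith [ht.1]
      have := h.anti h5 h6 (by linarith)
      linarith
    rw [intervalIntegral.integral_sub hKd (hKi _ _),
      intervalIntegral.integral_comp_sub_right (fun t => K t) d, add_sub_cancel_right] at h1
    have e4 := intervalIntegral.integral_add_adjacent_intervals (hKi S (S + d)) (hKi (S + d) T)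
    have e5 := intervalIntegral.integral_add_adjacent_intervals (hKi S (T - d)) (hKi (T - d) T)
    have h2 : 0 ≤ ∫ t in (T - d)..T, K t :=
      intervalIntegral.integral_nonneg (by linarith) (fun t ht => h.nonneg t (by linarith [ht.1]))
    have h3 : ∫ t in S..(S + d), K t ≤ K S * d := by
      have := intervalIntegral.integral_mono_on (a := S) (b := S + d) (by linarith) (hKi _ _)
        (_root_.intervalIntegrable_const (c := K S)) (fun t ht =>
          h.anti hS (show A ≤ t by linarith [ht.1]) ht.1)
      simp only [intervalIntegral.integral_const, add_sub_cancel_left, smul_eq_mul] at this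
      linarith
    linarith
  have h2I : ‖2 * ∫ t in S..T, f t‖ ≤ 3 * (K S * d) := by
    rw [key]
    refine (norm_sub_le _ _).trans ?_
    have := norm_add_le (∫ t in S..(S + d), f t) (∫ t in (S + d)..T, (f t - g t))
    linarith
  rw [norm_mul] at h2I
  norm_num at h2I
  linarith

/-! ### The one-sided transform -/

theorem CondI.exists_kernelTail {K : ℝ → ℝ} (hI : CondI K) (hII : CondII K) :
    ∃ A C, KernelTail K A C := by
  obtain ⟨A₀, hA₀⟩ := hI.eventually_antitone
  obtain ⟨c, hc, hlim⟩ := hII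
  obtain ⟨A₁, hA₁⟩ := (hlim.eventually_lt_const (show c < c + 1 by linarith)).exists_forall_of_atTop
  refine ⟨max 1 (max A₀ A₁), c + 1, hI.locallyIntegrable, le_max_left _ _, by linarith,
    hA₀.mono ?_, fun t ht => (hI.pos t ht.ne').le, ?_⟩
  · exact Set.Ici_subset_Ici.mpr ((le_max_left _ _).trans (le_max_right _ _))
  · intro t ht
    have h1 : 1 ≤ t := (le_max_left _ _).trans ht
    have h2 : A₁ ≤ t := ((le_max_right _ _).trans (le_max_right _ _)).trans ht
    rw [le_div_iff₀ (by linarith), mul_comm]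
    exact (hA₁ t h2).le

/-- A sublinear majorant of the one-sided transform, with an integrable square near `0`. -/
def majorant (D ω : ℝ) : ℝ := D * (1 + |ω| ^ (-(1 / 4) : ℝ))

namespace KernelTail

variable {K : ℝ → ℝ} {A C : ℝ}

theorem tendsto_zero (h : KernelTail K A C) : Tendsto K atTop (𝓝 0) := by
  have h1 : Tendsto (fun t : ℝ => C / t) atTop (𝓝 0) := tendsto_const_nhds.div_atTop tendsto_id
  refine tendsto_of_tendsto_of_tendsto_of_le_of_le' tendsto_const_nhds h1 ?_ ?_
  · filter_upwards [eventually_gt_atTop 0] with t ht using h.nonneg t ht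
  · filter_upwards [eventually_ge_atTop A] with t ht using h.le t ht

theorem halfTrunc_sub (h : KernelTail K A C) (ω S T : ℝ) :
    halfTrunc K ω T - halfTrunc K ω S = ∫ t in S..T, osc ω t * (K t : ℂ) :=
  intervalIntegral.integral_interval_sub_left
    (osc_mul_intervalIntegrable h.locallyIntegrable ω _ _)
    (osc_mul_intervalIntegrable h.locallyIntegrable ω _ _)

theorem exists_tendsto_halfTrunc (h : KernelTail K A C) {ω : ℝ} (hω : ω ≠ 0) :
    ∃ L, Tendsto (halfTrunc K ω) atTop (𝓝 L) := by
  have hω' : 0 < |ω| := abs_pos.mpr hω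
  refine cauchySeq_tendsto_of_complete (Metric.cauchySeq_iff'.mpr fun ε hε => ?_)
  have h1 : Tendsto (fun t => 5 * K t / |ω|) atTop (𝓝 (5 * 0 / |ω|)) :=
    (h.tendsto_zero.const_mul 5).div_const _
  rw [mul_zero, zero_div] at h1
  obtain ⟨N, hN, hNA⟩ := ((h1.eventually_lt_const hε).and (eventually_ge_atTop A)).exists
  refine ⟨N, fun n hn => ?_⟩
  rw [dist_eq_norm, h.halfTrunc_sub]
  exact (h.norm_integral_le hω hNA hn).trans_lt hN

end KernelTail

/-- The one-sided transform `∫_0^∞ e^{-iωt} K(t) dt`, as an improper integral. -/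
def halfTransform (K : ℝ → ℝ) (ω : ℝ) : ℂ := limUnder atTop (halfTrunc K ω)

theorem halfTrunc_neg (K : ℝ → ℝ) (ω T : ℝ) :
    halfTrunc K (-ω) T = conj (halfTrunc K ω T) := by
  simp only [halfTrunc, intervalIntegral, map_sub, ← integral_conj, map_mul, osc_neg,
    Complex.conj_ofReal]

/-- The real part of the truncated transform is the truncated cosine transform. -/
theorem KernelTail.re_halfTrunc {K : ℝ → ℝ} {A C : ℝ} (h : KernelTail K A C) (ω T : ℝ) :
    (halfTrunc K ω T).re = ∫ t in (0 : ℝ)..T, K t * Real.cos (ω * t) := by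
  have h1 := Complex.reCLM.intervalIntegral_comp_comm
    (osc_mul_intervalIntegrable h.locallyIntegrable ω 0 T)
  rw [halfTrunc]
  simp only [Complex.reCLM_apply] at h1
  rw [← h1]
  refine intervalIntegral.integral_congr fun t _ => ?_
  simp only [osc_eq, Complex.mul_re, Complex.sub_re, Complex.sub_im, Complex.ofReal_re,
    Complex.ofReal_im, Complex.mul_im, Complex.I_re, Complex.I_im]
  ring

namespace KernelTail

variable {K : ℝ → ℝ} {A C : ℝ}

theorem tendsto_halfTrunc (h : KernelTail K A C) {ω : ℝ} (hω : ω ≠ 0) :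
    Tendsto (halfTrunc K ω) atTop (𝓝 (halfTransform K ω)) :=
  tendsto_nhds_limUnder (h.exists_tendsto_halfTrunc hω)

theorem halfTransform_neg (h : KernelTail K A C) {ω : ℝ} (hω : ω ≠ 0) :
    halfTransform K (-ω) = conj (halfTransform K ω) := by
  refine tendsto_nhds_unique (h.tendsto_halfTrunc (neg_ne_zero.mpr hω)) ?_
  have := (Complex.continuous_conj.tendsto _).comp (h.tendsto_halfTrunc hω)
  refine this.congr fun T => ?_
  simp [halfTrunc_neg]

theorem re_halfTransform (h : KernelTail K A C) {ω : ℝ} (hω : ω ≠ 0) :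
    (halfTransform K ω).re = Kcos K ω := by
  have h1 := (Complex.continuous_re.tendsto _).comp (h.tendsto_halfTrunc hω)
  refine (Tendsto.limUnder_eq (h1.congr fun T => ?_)).symm
  exact h.re_halfTrunc ω T

/-- The tail of the one-sided transform, uniformly for `ω` away from `0`. -/
theorem norm_halfTransform_sub_le (h : KernelTail K A C) {ω : ℝ} (hω : ω ≠ 0) {S : ℝ}
    (hS : A ≤ S) : ‖halfTransform K ω - halfTrunc K ω S‖ ≤ 5 * K S / |ω| := by
  refine le_of_tendsto ((h.tendsto_halfTrunc hω).sub_const (halfTrunc K ω S)).norm ?_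
  filter_upwards [eventually_ge_atTop S] with T hT
  rw [h.halfTrunc_sub]
  exact h.norm_integral_le hω hS hT

theorem norm_halfTrunc_le_integral (h : KernelTail K A C) (ω : ℝ) {T B : ℝ} (hT : 0 ≤ T)
    (hTB : T ≤ B) : ‖halfTrunc K ω T‖ ≤ ∫ t in (0 : ℝ)..B, K t := by
  have hi := h.locallyIntegrable.intervalIntegrable_real
  have h1 : ‖halfTrunc K ω T‖ ≤ ∫ t in (0 : ℝ)..T, K t := by
    refine intervalIntegral.norm_integral_le_of_norm_le hT ?_ (hi _ _)
    filter_upwards with t ht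
    rw [norm_mul, norm_osc, one_mul, Complex.norm_real, Real.norm_eq_abs,
      abs_of_nonneg (h.nonneg t ht.1)]
  have h2 : 0 ≤ ∫ t in T..B, K t := by
    refine intervalIntegral.integral_nonneg_of_ae_restrict hTB ?_
    have : ∀ᵐ t ∂(volume : Measure ℝ), t ≠ T := by simp [ae_iff]
    filter_upwards [ae_restrict_mem measurableSet_Icc, ae_restrict_of_ae this] with t ht ht'
    exact h.nonneg t (hT.trans_lt (lt_of_le_of_ne ht.1 (Ne.symm ht')))
  rw [← intervalIntegral.integral_add_adjacent_intervals (hi 0 T) (hi T B)]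
  linarith

theorem integral_le_log (h : KernelTail K A C) {B : ℝ} (hB : A ≤ B) :
    ∫ t in A..B, K t ≤ C * Real.log B := by
  have hA := h.one_le
  have h0 : (0 : ℝ) ∉ Set.uIcc A B := by
    rw [Set.uIcc_of_le hB]; intro h; linarith [h.1]
  have h1 : ∫ t in A..B, K t ≤ ∫ t in A..B, C * t⁻¹ :=
    intervalIntegral.integral_mono_on hB (h.locallyIntegrable.intervalIntegrable_real _ _)
      ((intervalIntegral.intervalIntegrable_inv (fun t ht h' => h0 (h' ▸ ht))
        continuousOn_id).const_mul C) (fun t ht => by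
        have := h.le t ht.1
        rwa [div_eq_mul_inv] at this)
  rw [intervalIntegral.integral_const_mul, integral_inv_of_pos (by linarith) (by linarith)] at h1
  refine h1.trans ?_
  have hBA : 0 < B / A := div_pos (by linarith) (by linarith)
  exact mul_le_mul_of_nonneg_left
    (Real.log_le_log hBA (div_le_self (by linarith) hA)) h.C_pos.le

/-- The one-sided truncations are dominated by `D (1 + |ω|^{-1/4})`, uniformly in the truncation:
up to `1 / |ω|` the kernel contributes at most a logarithm, and beyond it the oscillation keeps
the integral bounded. -/
theorem exists_norm_halfTrunc_le (h : KernelTail K A C) :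
    ∃ D, 0 < D ∧ ∀ ω, ω ≠ 0 → ∀ T, 0 ≤ T → ‖halfTrunc K ω T‖ ≤ majorant D ω := by
  set M := ∫ t in (0 : ℝ)..A, K t with hM
  have hA := h.one_le
  have hC := h.C_pos
  have hM0 : 0 ≤ M := by
    have := h.norm_halfTrunc_le_integral 0 le_rfl (show 0 ≤ A by linarith)
    exact (norm_nonneg _).trans this
  refine ⟨M + 4 * C * A + 5 * C, by positivity, fun ω hω T hT => ?_⟩
  have hω' : 0 < |ω| := abs_pos.mpr hω
  -- Below `1 / |ω|` there is no cancellation to use; `A` is needed for the tail bound to apply.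
  set B := max A (1 / |ω|) with hB
  have hAB : A ≤ B := le_max_left _ _
  have hB0 : 0 < B := by linarith
  have hωB : 1 / |ω| ≤ B := le_max_right _ _
  set q := |ω| ^ (-(1 / 4) : ℝ) with hq
  have hq0 : 0 ≤ q := Real.rpow_nonneg (abs_nonneg _) _
  have hi := h.locallyIntegrable.intervalIntegrable_real
  have hlog : Real.log B ≤ 4 * (A + q) := by
    have h1 := Real.log_le_rpow_div hB0.le (show (0 : ℝ) < 1 / 4 by norm_num)
    have h2 : B ^ (1 / 4 : ℝ) ≤ A + q := by
      rcases max_cases A (1 / |ω|) with ⟨e, _⟩ | ⟨e, _⟩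
      · rw [hB, e]
        have : A ^ (1 / 4 : ℝ) ≤ A ^ (1 : ℝ) :=
          Real.rpow_le_rpow_of_exponent_le hA (by norm_num)
        rw [Real.rpow_one] at this
        linarith
      · rw [hB, e, hq, one_div, Real.inv_rpow hω'.le, ← Real.rpow_neg hω'.le]
        linarith
    linarith
  have hIB : ∫ t in (0 : ℝ)..B, K t ≤ M + 4 * C * (A + q) := by
    rw [← intervalIntegral.integral_add_adjacent_intervals (hi 0 A) (hi A B)]
    have h1 := h.integral_le_log hAB
    have h2 : C * Real.log B ≤ C * (4 * (A + q)) := by gcongr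
    linarith
  have hmain : ‖halfTrunc K ω T‖ ≤ M + 4 * C * (A + q) + 5 * C := by
    rcases le_or_gt T B with hTB | hTB
    · have := h.norm_halfTrunc_le_integral ω hT hTB
      linarith
    · have h1 := h.norm_integral_le hω hAB hTB.le
      rw [← h.halfTrunc_sub] at h1
      have h2 := h.norm_halfTrunc_le_integral ω hB0.le le_rfl
      have h3 : 5 * K B / |ω| ≤ 5 * C := by
        rw [div_le_iff₀ hω']
        have h4 := h.le B hAB
        have h5 : C / B ≤ C * |ω| := by
          rw [div_le_iff₀ hB0, mul_assoc]
          have : 1 ≤ |ω| * B := by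
            rwa [div_le_iff₀ hω', mul_comm] at hωB
          nlinarith
        linarith
      have h6 := norm_add_le (halfTrunc K ω T - halfTrunc K ω B) (halfTrunc K ω B)
      rw [sub_add_cancel] at h6
      linarith
  refine hmain.trans ?_
  rw [majorant, ← hq]
  have : 4 * C * q ≤ (M + 4 * C * A + 5 * C) * q := by
    gcongr
    nlinarith
  nlinarith

theorem continuous_halfTrunc (h : KernelTail K A C) (T : ℝ) :
    Continuous fun ω => halfTrunc K ω T := by
  have hi := h.locallyIntegrable.intervalIntegrable_real 0 T
  refine intervalIntegral.continuous_of_dominated_interval (bound := fun t => |K t|) ?_ ?_ hi.abs ?_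
  · intro ω
    exact (osc_mul_intervalIntegrable h.locallyIntegrable ω 0 T).def'.aestronglyMeasurable
  · intro ω
    filter_upwards with t _
    simp
  · filter_upwards with t _
    exact (osc_continuous_left t).mul continuous_const

theorem continuousOn_halfTransform (h : KernelTail K A C) :
    ContinuousOn (halfTransform K) {0}ᶜ := by
  have hlu : TendstoLocallyUniformlyOn (fun T ω => halfTrunc K ω T) (halfTransform K) atTop
      {0}ᶜ := by
    refine Metric.tendstoLocallyUniformlyOn_iff.mpr fun ε hε ω hω => ?_
    have hω' : 0 < |ω| := abs_pos.mpr hω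
    refine ⟨{x | |ω| / 2 < |x|}, mem_nhdsWithin_of_mem_nhds
      ((isOpen_lt continuous_const continuous_abs).mem_nhds (half_lt_self hω')), ?_⟩
    have h1 : Tendsto (fun t => 5 * K t / (|ω| / 2)) atTop (𝓝 (5 * 0 / (|ω| / 2))) :=
      (h.tendsto_zero.const_mul 5).div_const _
    rw [mul_zero, zero_div] at h1
    filter_upwards [h1.eventually_lt_const hε, eventually_ge_atTop A] with T hT hTA x hx
    have hx' : |ω| / 2 < |x| := hx
    rw [dist_eq_norm]
    refine (h.norm_halfTransform_sub_le (abs_pos.mp (by linarith)) hTA).trans_lt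
      (lt_of_le_of_lt ?_ hT)
    have := h.one_le
    have := h.nonneg T (by linarith)
    gcongr
  exact hlu.continuousOn (Frequently.of_forall fun T => (h.continuous_halfTrunc T).continuousOn)

theorem norm_halfTransform_le (h : KernelTail K A C) {D : ℝ}
    (hD : ∀ ω, ω ≠ 0 → ∀ T, 0 ≤ T → ‖halfTrunc K ω T‖ ≤ majorant D ω) {ω : ℝ} (hω : ω ≠ 0) :
    ‖halfTransform K ω‖ ≤ majorant D ω := by
  refine le_of_tendsto (h.tendsto_halfTrunc hω).norm ?_
  filter_upwards [eventually_ge_atTop 0] with T hT using hD ω hω T hT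

end KernelTail

/-- A kernel asymptotic to `c / t` has a divergent integral, and the oscillating part of the
cosine transform beyond `1 / |ω|` is bounded, so the cosine transform blows up at `0`. -/
theorem KernelTail.exists_one_le_re_near_zero {K : ℝ → ℝ} {A C : ℝ} (h : KernelTail K A C)
    (hII : CondII K) : ∃ δ, 0 < δ ∧ ∀ ω, ω ≠ 0 → |ω| < δ → 1 ≤ (halfTransform K ω).re := by
  obtain ⟨c, hc, hlim⟩ := hII
  have hA := h.one_le
  have hC := h.C_pos
  have hi := h.locallyIntegrable.intervalIntegrable_real
  obtain ⟨A₁, hA₁⟩ := (hlim.eventually_const_lt (show c / 2 < c by linarith)).exists_forall_of_atTop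
  set A₂ := max A A₁ with hA₂
  have hA₂0 : 0 < A₂ := by linarith [le_max_left A A₁]
  have hlow : ∀ B, A₂ ≤ B → c / 2 * Real.log (B / A₂) ≤ ∫ t in (0 : ℝ)..B, K t := by
    intro B hB
    have h0 : (0 : ℝ) ∉ Set.uIcc A₂ B := by
      rw [Set.uIcc_of_le hB]; intro h; linarith [h.1]
    have h1 : ∫ t in A₂..B, c / 2 * t⁻¹ ≤ ∫ t in A₂..B, K t :=
      intervalIntegral.integral_mono_on hB
        ((intervalIntegral.intervalIntegrable_inv (fun t ht h' => h0 (h' ▸ ht))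
          continuousOn_id).const_mul _) (hi _ _) (fun t ht => by
          have h2 := hA₁ t ((le_max_right _ _).trans ht.1)
          have h3 : 0 < t := hA₂0.trans_le ht.1
          rw [← div_eq_mul_inv, div_le_iff₀ h3, mul_comm]
          exact h2.le)
    rw [intervalIntegral.integral_const_mul, integral_inv_of_pos hA₂0 (by linarith)] at h1
    have h4 : 0 ≤ ∫ t in (0 : ℝ)..A₂, K t :=
      (norm_nonneg _).trans (h.norm_halfTrunc_le_integral 0 le_rfl hA₂0.le)
    rw [← intervalIntegral.integral_add_adjacent_intervals (hi 0 A₂) (hi A₂ B)]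
    linarith
  have htop : Tendsto (fun B => c / 2 * Real.log (B / A₂)) atTop atTop :=
    (Real.tendsto_log_atTop.comp (tendsto_id.atTop_div_const hA₂0)).const_mul_atTop (by linarith)
  obtain ⟨B₀, hB₀⟩ := (htop.eventually_ge_atTop (2 * (1 + 5 * C))).exists_forall_of_atTop
  set B₁ := max A₂ B₀ with hB₁
  have hB₁0 : 0 < B₁ := hA₂0.trans_le (le_max_left _ _)
  refine ⟨1 / B₁, by positivity, fun ω hω hωδ => ?_⟩
  have hω' : 0 < |ω| := abs_pos.mpr hω
  set B := 1 / |ω| with hB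
  have hBB : B₁ ≤ B := by
    rw [hB, le_div_iff₀ hω', mul_comm]
    rw [lt_div_iff₀ hB₁0] at hωδ
    exact hωδ.le
  have hB2 : A₂ ≤ B := (le_max_left _ _).trans hBB
  have hBA : A ≤ B := (le_max_left _ _).trans hB2
  have hB0 : 0 < B := by linarith
  have h1 := hB₀ B ((le_max_right _ _).trans hBB)
  have h2 := hlow B hB2
  have h3 := h.norm_halfTransform_sub_le hω hBA
  have h4 : 5 * K B / |ω| ≤ 5 * C := by
    rw [div_le_iff₀ hω']
    have := h.le B hBA
    rw [hB, div_div_eq_mul_div, div_one] at this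
    linarith
  -- The value of `K` at the endpoint `0` is unconstrained, hence the open interval.
  have h5 : 1 / 2 * ∫ t in (0 : ℝ)..B, K t ≤ (halfTrunc K ω B).re := by
    rw [h.re_halfTrunc, ← intervalIntegral.integral_const_mul]
    refine intervalIntegral.integral_mono_on_of_le_Ioo hB0.le ((hi _ _).const_mul _)
      ((hi _ _).mul_continuousOn (by fun_prop)) fun t ht => ?_
    have hK := h.nonneg t ht.1
    -- Here `|ω t| ≤ 1 < π / 3`.
    have hcos : 1 / 2 ≤ Real.cos (ω * t) := by
      rw [← Real.cos_pi_div_three, ← Real.cos_abs (ω * t)]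
      have h6 : |ω * t| ≤ 1 := by
        rw [abs_mul, abs_of_pos ht.1]
        have := ht.2
        rw [hB, lt_div_iff₀ hω'] at this
        linarith
      exact Real.cos_le_cos_of_nonneg_of_le_pi (abs_nonneg _)
        (by linarith [Real.pi_pos]) (by linarith [Real.pi_gt_three])
    nlinarith
  have h7 := (Complex.abs_re_le_norm (halfTransform K ω - halfTrunc K ω B)).trans (h3.trans h4)
  rw [Complex.sub_re] at h7
  have := (abs_le.mp h7).1
  linarith

theorem KernelTail.exists_le_re {K : ℝ → ℝ} {A C : ℝ} (h : KernelTail K A C) (hI : CondI K)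
    (hII : CondII K) (R : ℝ) :
    ∃ κ, 0 < κ ∧ ∀ ω, ω ≠ 0 → |ω| ≤ R → κ ≤ (halfTransform K ω).re := by
  obtain ⟨δ, hδ, hδ1⟩ := h.exists_one_le_re_near_zero hII
  have hpos : ∀ ω, ω ≠ 0 → 0 < (halfTransform K ω).re := fun ω hω => by
    rw [h.re_halfTransform hω]; exact hI.Kcos_pos ω hω
  set S : Set ℝ := {ω | δ ≤ |ω|} ∩ Metric.closedBall 0 R with hS
  have hScomp : IsCompact S :=
    (isCompact_closedBall 0 R).inter_left (isClosed_le continuous_const continuous_abs)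
  have hS0 : ∀ ω ∈ S, ω ≠ 0 := fun ω hω => abs_pos.mp (hδ.trans_le hω.1)
  have hcont : ContinuousOn (fun ω => (halfTransform K ω).re) S :=
    Complex.continuous_re.comp_continuousOn (h.continuousOn_halfTransform.mono hS0)
  rcases S.eq_empty_or_nonempty with hE | hE
  · refine ⟨1, one_pos, fun ω hω hR => ?_⟩
    rcases lt_or_ge |ω| δ with h1 | h1
    · exact hδ1 ω hω h1
    · have : ω ∈ S := ⟨h1, by simpa using hR⟩
      simp [hE] at this
  · obtain ⟨x, hx, hmin⟩ := hScomp.exists_isMinOn hE hcont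
    refine ⟨min 1 (halfTransform K x).re, lt_min one_pos (hpos x (hS0 x hx)), fun ω hω hR => ?_⟩
    rcases lt_or_ge |ω| δ with h1 | h1
    · exact (min_le_left _ _).trans (hδ1 ω hω h1)
    · exact (min_le_right _ _).trans (hmin ⟨h1, by simpa using hR⟩)

/-! ### The two-sided transform and the spectral density -/

/-- The reflected causal kernel `t ↦ K⁺(-t)`. -/
def Kminus (K : ℝ → ℝ) : ℝ → ℝ := fun t => Kplus K (-t)

theorem locallyIntegrable_Kplus {K : ℝ → ℝ} (hK : LocallyIntegrable K volume) :
    LocallyIntegrable (Kplus K) volume := by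
  intro x
  obtain ⟨s, hs, hint⟩ := hK x
  exact ⟨s, hs, hint.indicator measurableSet_Ici⟩

theorem locallyIntegrable_Kminus {K : ℝ → ℝ} (hK : LocallyIntegrable K volume) :
    LocallyIntegrable (Kminus K) volume := by
  rw [locallyIntegrable_iff]
  intro k hk
  have h1 := (locallyIntegrable_Kplus hK).integrableOn_isCompact hk.neg
  have h2 : IntegrableOn (Kplus K ∘ Neg.neg) (Neg.neg ⁻¹' (-k)) volume :=
    ((Measure.measurePreserving_neg (volume : Measure ℝ)).integrableOn_comp_preimage
      (Homeomorph.neg ℝ).measurableEmbedding).mpr h1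
  rw [Set.neg_preimage, neg_neg] at h2
  exact h2

theorem truncFourier_Kplus (K : ℝ → ℝ) (ω : ℝ) {T : ℝ} (hT : 0 ≤ T) :
    truncFourier (Kplus K) ω T = halfTrunc K ω T := by
  rw [truncFourier, halfTrunc, intervalIntegral.integral_of_le (by linarith),
    intervalIntegral.integral_of_le hT]
  have e : ∀ t : ℝ, Complex.exp (-(Complex.I * ω * t)) * (Kplus K t : ℂ) =
      (Set.Ici (0 : ℝ)).indicator (fun t => osc ω t * (K t : ℂ)) t := by
    intro t
    by_cases ht : t ∈ Set.Ici (0 : ℝ) <;> simp [Kplus, ht, osc]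
  simp only [e]
  rw [integral_indicator measurableSet_Ici, Measure.restrict_restrict measurableSet_Ici]
  refine setIntegral_congr_set ?_
  have h0 : ∀ᵐ t ∂(volume : Measure ℝ), t ≠ 0 := by simp [ae_iff]
  filter_upwards [h0] with t ht
  refine propext ⟨fun h => ⟨lt_of_le_of_ne h.1 (Ne.symm ht), h.2.2⟩, fun h => ⟨?_, ?_, h.2⟩⟩
  · exact h.1.le
  · linarith [h.1]

theorem truncFourier_Kminus (K : ℝ → ℝ) (ω : ℝ) {T : ℝ} (hT : 0 ≤ T) :
    truncFourier (Kminus K) ω T = conj (halfTrunc K ω T) := by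
  rw [← halfTrunc_neg, ← truncFourier_Kplus K (-ω) hT, truncFourier, truncFourier]
  have := intervalIntegral.integral_comp_neg (a := -T) (b := T)
    (fun t : ℝ => Complex.exp (-(Complex.I * (-ω : ℝ) * t)) * (Kplus K t : ℂ))
  rw [neg_neg] at this
  rw [← this]
  simp [Kminus]

theorem ae_eq_Kplus_add_Kminus {K : ℝ → ℝ} (heven : ∀ t, K (-t) = K t) :
    ∀ᵐ t ∂(volume : Measure ℝ), K t = Kplus K t + Kminus K t := by
  have h0 : ∀ᵐ t ∂(volume : Measure ℝ), t ≠ 0 := by simp [ae_iff]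
  filter_upwards [h0] with t ht
  rcases lt_or_gt_of_ne ht with h | h
  · simp [Kplus, Kminus, h.le, not_le.mpr h, heven]
  · simp [Kplus, Kminus, h.le, not_le.mpr h]

theorem truncFourier_intervalIntegrable {k : ℝ → ℝ} (hk : LocallyIntegrable k volume)
    (ω a b : ℝ) : IntervalIntegrable
      (fun t : ℝ => Complex.exp (-(Complex.I * ω * t)) * (k t : ℂ)) volume a b :=
  osc_mul_intervalIntegrable hk ω a b

theorem truncFourier_even {K : ℝ → ℝ} (hK : LocallyIntegrable K volume)
    (heven : ∀ t, K (-t) = K t) (ω : ℝ) {T : ℝ} (hT : 0 ≤ T) :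
    truncFourier K ω T = halfTrunc K ω T + conj (halfTrunc K ω T) := by
  rw [← truncFourier_Kminus K ω hT, ← truncFourier_Kplus K ω hT, truncFourier, truncFourier,
    truncFourier, ← intervalIntegral.integral_add
      (truncFourier_intervalIntegrable (locallyIntegrable_Kplus hK) _ _ _)
      (truncFourier_intervalIntegrable (locallyIntegrable_Kminus hK) _ _ _)]
  refine intervalIntegral.integral_congr_ae ?_
  filter_upwards [ae_eq_Kplus_add_Kminus heven] with t ht _
  rw [← mul_add, ← Complex.ofReal_add, ← ht]

/-- A kernel for which the Fourier transform makes sense as an improper integral off `0`: it is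
locally integrable and bounded away from a compact set, and its truncated transforms converge
under the majorant `D (1 + |ω|^{-1/4})`. -/
structure TameKernel (k : ℝ → ℝ) (D : ℝ) : Prop where
  locallyIntegrable : LocallyIntegrable k volume
  bounded : ∃ A M : ℝ, 0 ≤ M ∧ ∀ t, A < |t| → |k t| ≤ M
  norm_le : ∀ ω, ω ≠ 0 → ∀ T, 0 ≤ T → ‖truncFourier k ω T‖ ≤ majorant D ω
  tendsto : ∀ ω, ω ≠ 0 → Tendsto (truncFourier k ω) atTop (𝓝 (improperFourier k ω))

namespace KernelTail

variable {K : ℝ → ℝ} {A C : ℝ}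

theorem tendsto_truncFourier_Kplus (h : KernelTail K A C) {ω : ℝ} (hω : ω ≠ 0) :
    Tendsto (truncFourier (Kplus K) ω) atTop (𝓝 (halfTransform K ω)) := by
  refine (h.tendsto_halfTrunc hω).congr' ?_
  filter_upwards [eventually_ge_atTop 0] with T hT using (truncFourier_Kplus K ω hT).symm

theorem tendsto_truncFourier_Kminus (h : KernelTail K A C) {ω : ℝ} (hω : ω ≠ 0) :
    Tendsto (truncFourier (Kminus K) ω) atTop (𝓝 (conj (halfTransform K ω))) := by
  refine ((Complex.continuous_conj.tendsto _).comp (h.tendsto_halfTrunc hω)).congr' ?_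
  filter_upwards [eventually_ge_atTop 0] with T hT using (truncFourier_Kminus K ω hT).symm

theorem tendsto_truncFourier (h : KernelTail K A C) (heven : ∀ t, K (-t) = K t) {ω : ℝ}
    (hω : ω ≠ 0) :
    Tendsto (truncFourier K ω) atTop (𝓝 ((2 * (halfTransform K ω).re : ℝ) : ℂ)) := by
  have h1 := h.tendsto_halfTrunc hω
  have h2 := h1.add ((Complex.continuous_conj.tendsto _).comp h1)
  rw [Complex.add_conj] at h2
  refine h2.congr' ?_
  filter_upwards [eventually_ge_atTop 0] with T hT
    using (truncFourier_even h.locallyIntegrable heven ω hT).symm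

theorem improperFourier_Kplus (h : KernelTail K A C) {ω : ℝ} (hω : ω ≠ 0) :
    improperFourier (Kplus K) ω = halfTransform K ω :=
  (h.tendsto_truncFourier_Kplus hω).limUnder_eq

theorem improperFourier_Kminus (h : KernelTail K A C) {ω : ℝ} (hω : ω ≠ 0) :
    improperFourier (Kminus K) ω = conj (halfTransform K ω) :=
  (h.tendsto_truncFourier_Kminus hω).limUnder_eq

theorem improperFourier_eq (h : KernelTail K A C) (heven : ∀ t, K (-t) = K t) {ω : ℝ}
    (hω : ω ≠ 0) : improperFourier K ω = ((2 * (halfTransform K ω).re : ℝ) : ℂ) :=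
  (h.tendsto_truncFourier heven hω).limUnder_eq

theorem abs_le_of_lt (h : KernelTail K A C) {t : ℝ} (ht : A < t) : |K t| ≤ C := by
  have hA := h.one_le
  rw [abs_of_nonneg (h.nonneg t (by linarith))]
  exact (h.le t ht.le).trans (div_le_self h.C_pos.le (by linarith))

theorem abs_Kplus_le (h : KernelTail K A C) {t : ℝ} (ht : A < |t|) : |Kplus K t| ≤ C := by
  by_cases h0 : 0 ≤ t
  · rw [abs_of_nonneg h0] at ht
    simpa [Kplus, h0] using h.abs_le_of_lt ht
  · simpa [Kplus, h0] using h.C_pos.le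

theorem tameKernel_Kplus (h : KernelTail K A C) {D : ℝ}
    (hD : ∀ ω, ω ≠ 0 → ∀ T, 0 ≤ T → ‖halfTrunc K ω T‖ ≤ majorant D ω) :
    TameKernel (Kplus K) D where
  locallyIntegrable := locallyIntegrable_Kplus h.locallyIntegrable
  bounded := ⟨A, C, h.C_pos.le, fun _ ht => h.abs_Kplus_le ht⟩
  norm_le ω hω T hT := by rw [truncFourier_Kplus K ω hT]; exact hD ω hω T hT
  tendsto ω hω := by rw [h.improperFourier_Kplus hω]; exact h.tendsto_truncFourier_Kplus hω

theorem tameKernel_Kminus (h : KernelTail K A C) {D : ℝ}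
    (hD : ∀ ω, ω ≠ 0 → ∀ T, 0 ≤ T → ‖halfTrunc K ω T‖ ≤ majorant D ω) :
    TameKernel (Kminus K) D where
  locallyIntegrable := locallyIntegrable_Kminus h.locallyIntegrable
  bounded := ⟨A, C, h.C_pos.le, fun t ht => h.abs_Kplus_le (by rwa [abs_neg])⟩
  norm_le ω hω T hT := by
    rw [truncFourier_Kminus K ω hT, RCLike.norm_conj]; exact hD ω hω T hT
  tendsto ω hω := by rw [h.improperFourier_Kminus hω]; exact h.tendsto_truncFourier_Kminus hω

theorem tameKernel (h : KernelTail K A C) (heven : ∀ t, K (-t) = K t) {D : ℝ}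
    (hD : ∀ ω, ω ≠ 0 → ∀ T, 0 ≤ T → ‖halfTrunc K ω T‖ ≤ majorant D ω) :
    TameKernel K (2 * D) where
  locallyIntegrable := h.locallyIntegrable
  bounded := by
    refine ⟨A, C, h.C_pos.le, fun t ht => ?_⟩
    have : K t = K |t| := by rcases abs_choice t with e | e <;> simp [e, heven]
    rw [this]
    exact h.abs_le_of_lt ht
  norm_le ω hω T hT := by
    rw [truncFourier_even h.locallyIntegrable heven ω hT]
    have h1 := norm_add_le (halfTrunc K ω T) (conj (halfTrunc K ω T))
    rw [RCLike.norm_conj] at h1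
    have h2 := hD ω hω T hT
    have h3 : majorant (2 * D) ω = 2 * majorant D ω := by simp only [majorant]; ring
    linarith
  tendsto ω hω := by rw [h.improperFourier_eq heven hω]; exact h.tendsto_truncFourier heven hω

/-- The formula for the spectral density in terms of the one-sided transform. -/
theorem spectralDensity_eq (h : KernelTail K A C) (heven : ∀ t, K (-t) = K t) (m β : ℝ) {ω : ℝ}
    (hω : ω ≠ 0) : spectralDensity m β K ω = β * (2 * (halfTransform K ω).re) /
      (2 * Real.pi * ‖(m : ℂ) * Complex.I * ω + β * halfTransform K ω‖ ^ 2) := by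
  rw [spectralDensity, h.improperFourier_Kplus hω, h.improperFourier_eq heven hω,
    Complex.ofReal_re]

end KernelTail

/-- The Fourier symbol `m i ω + β K̂⁺(ω)` of the Langevin operator. -/
def symbol (m β : ℝ) (K : ℝ → ℝ) (ω : ℝ) : ℂ :=
  (m : ℂ) * Complex.I * ω + β * halfTransform K ω

theorem symbol_re (m β : ℝ) (K : ℝ → ℝ) (ω : ℝ) :
    (symbol m β K ω).re = β * (halfTransform K ω).re := by
  simp [symbol]

theorem ae_ne_zero_real : ∀ᵐ ω ∂(volume : Measure ℝ), ω ≠ 0 := by simp [ae_iff]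

namespace KernelTail

variable {K : ℝ → ℝ} {A C : ℝ}

theorem aestronglyMeasurable_halfTransform (h : KernelTail K A C) :
    AEStronglyMeasurable (halfTransform K) volume := by
  rw [← restrict_compl_singleton (μ := (volume : Measure ℝ)) 0]
  exact h.continuousOn_halfTransform.aestronglyMeasurable (measurableSet_singleton 0).compl

theorem aestronglyMeasurable_symbol (h : KernelTail K A C) (m β : ℝ) :
    AEStronglyMeasurable (symbol m β K) volume := by
  have h1 : Continuous fun ω : ℝ => (m : ℂ) * Complex.I * ω := by fun_prop
  exact h1.aestronglyMeasurable.add (h.aestronglyMeasurable_halfTransform.const_mul _)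

theorem re_halfTransform_pos (h : KernelTail K A C) (hI : CondI K) {ω : ℝ} (hω : ω ≠ 0) :
    0 < (halfTransform K ω).re := by
  rw [h.re_halfTransform hω]; exact hI.Kcos_pos ω hω

theorem norm_symbol_pos (h : KernelTail K A C) (hI : CondI K) {m β : ℝ} (hβ : 0 < β) {ω : ℝ}
    (hω : ω ≠ 0) : 0 < ‖symbol m β K ω‖ := by
  refine lt_of_lt_of_le ?_ (Complex.abs_re_le_norm _)
  rw [symbol_re]
  exact abs_pos.mpr (mul_pos hβ (h.re_halfTransform_pos hI hω)).ne'

theorem spectralDensity_mul_norm_symbol_sq (h : KernelTail K A C) (hI : CondI K) {m β : ℝ}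
    (hβ : 0 < β) {ω : ℝ} (hω : ω ≠ 0) :
    spectralDensity m β K ω * ‖symbol m β K ω‖ ^ 2 = β / Real.pi * (halfTransform K ω).re := by
  have h1 := h.norm_symbol_pos hI (m := m) hβ hω
  rw [h.spectralDensity_eq hI.even m β hω, ← symbol]
  have := Real.pi_pos
  field_simp

theorem spectralDensity_pos (h : KernelTail K A C) (hI : CondI K) {m β : ℝ}
    (hβ : 0 < β) {ω : ℝ} (hω : ω ≠ 0) : 0 < spectralDensity m β K ω := by
  have h1 := h.norm_symbol_pos hI (m := m) hβ hω
  have h2 := h.re_halfTransform_pos hI hω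
  rw [h.spectralDensity_eq hI.even m β hω, ← symbol]
  have := Real.pi_pos
  positivity

/-- At bounded frequencies the real part of the symbol is bounded below, because the cosine
transform is positive and blows up at `0`; at high frequencies the inertial term `m i ω`
dominates. -/
theorem exists_spectralDensity_le (h : KernelTail K A C) (hI : CondI K) (hII : CondII K)
    {m β : ℝ} (hm : 0 < m) (hβ : 0 < β) :
    ∃ M, 0 < M ∧ ∀ ω, ω ≠ 0 → spectralDensity m β K ω ≤ M * (1 + ω ^ 2)⁻¹ := by
  obtain ⟨D, hD0, hD⟩ := h.exists_norm_halfTrunc_le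
  set R := max 1 (4 * β * D / m) with hR
  have hR1 : 1 ≤ R := le_max_left _ _
  obtain ⟨κ, hκ, hκR⟩ := h.exists_le_re hI hII R
  have hπ := Real.pi_pos
  refine ⟨max ((1 + R ^ 2) / (Real.pi * β * κ)) (16 * β * D / (Real.pi * m ^ 2)),
    lt_max_of_lt_left (by positivity), fun ω hω => ?_⟩
  have hre := h.re_halfTransform_pos hI hω
  have hs := h.norm_symbol_pos hI (m := m) hβ hω
  have hω2 : |ω| ^ 2 = ω ^ 2 := sq_abs ω
  have hden : (0 : ℝ) < 1 + ω ^ 2 := by positivity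
  rw [h.spectralDensity_eq hI.even m β hω, ← symbol, ← div_eq_mul_inv, le_div_iff₀ hden,
    div_mul_eq_mul_div, div_le_iff₀ (by positivity)]
  rcases le_or_gt |ω| R with hωR | hωR
  · have hk := hκR ω hω hωR
    have h1 : (β * (halfTransform K ω).re) ^ 2 ≤ ‖symbol m β K ω‖ ^ 2 := by
      rw [← symbol_re m, ← sq_abs]
      exact pow_le_pow_left₀ (abs_nonneg _) (Complex.abs_re_le_norm _) 2
    have h2 : 1 + ω ^ 2 ≤ 1 + R ^ 2 := by
      rw [← hω2]; gcongr
    calc β * (2 * (halfTransform K ω).re) * (1 + ω ^ 2)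
        ≤ β * (2 * (halfTransform K ω).re) * (1 + R ^ 2) := by gcongr
      _ ≤ β * (2 * (halfTransform K ω).re) * (1 + R ^ 2) * ((halfTransform K ω).re / κ) := by
          refine le_mul_of_one_le_right (by positivity) ?_
          rwa [one_le_div hκ]
      _ = (1 + R ^ 2) / (Real.pi * β * κ) *
          (2 * Real.pi * (β * (halfTransform K ω).re) ^ 2) := by
          field_simp
      _ ≤ _ := by
          gcongr
          exact le_max_left _ _
  · have hω1 : 1 < |ω| := hR1.trans_lt hωR
    have hmaj : majorant D ω ≤ 2 * D := by
      have : |ω| ^ (-(1 / 4) : ℝ) ≤ 1 :=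
        Real.rpow_le_one_of_one_le_of_nonpos hω1.le (by norm_num)
      rw [majorant]
      nlinarith
    have hH := (h.norm_halfTransform_le hD hω).trans hmaj
    have hre2 : (halfTransform K ω).re ≤ 2 * D := (Complex.re_le_norm _).trans hH
    have hmR : 4 * β * D ≤ m * |ω| := by
      have h1 : 4 * β * D / m ≤ |ω| := (le_max_right _ _).trans hωR.le
      rwa [div_le_iff₀ hm, mul_comm |ω|] at h1
    have hsym : m * |ω| / 2 ≤ ‖symbol m β K ω‖ := by
      have h1 := norm_sub_le (symbol m β K ω) (β * halfTransform K ω)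
      have e1 : ‖symbol m β K ω - β * halfTransform K ω‖ = m * |ω| := by
        rw [symbol, add_sub_cancel_right]
        simp [abs_of_pos hm]
      have e2 : ‖(β : ℂ) * halfTransform K ω‖ ≤ β * (2 * D) := by
        rw [norm_mul, Complex.norm_real, Real.norm_eq_abs, abs_of_pos hβ]
        gcongr
      linarith
    have h1 : (m * |ω| / 2) ^ 2 ≤ ‖symbol m β K ω‖ ^ 2 := by gcongr
    have h2 : 1 + ω ^ 2 ≤ 2 * |ω| ^ 2 := by
      have : (1 : ℝ) ≤ |ω| ^ 2 := one_le_pow₀ hω1.le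
      rw [hω2] at *
      linarith
    calc β * (2 * (halfTransform K ω).re) * (1 + ω ^ 2)
        ≤ β * (2 * (2 * D)) * (2 * |ω| ^ 2) := by gcongr
      _ = 16 * β * D / (Real.pi * m ^ 2) * (2 * Real.pi * (m * |ω| / 2) ^ 2) := by
          field_simp; ring
      _ ≤ _ := by
          gcongr
          exact le_max_right _ _

theorem aemeasurable_spectralDensity (h : KernelTail K A C) (heven : ∀ t, K (-t) = K t)
    (m β : ℝ) : AEMeasurable (spectralDensity m β K) volume := by
  have h1 : AEMeasurable (fun ω => β * (2 * (halfTransform K ω).re) /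
      (2 * Real.pi * ‖symbol m β K ω‖ ^ 2)) volume := by
    have h2 := h.aestronglyMeasurable_halfTransform.aemeasurable
    have h3 := (h.aestronglyMeasurable_symbol m β).aemeasurable
    have h4 := Complex.measurable_re.comp_aemeasurable h2
    exact ((h4.const_mul 2).const_mul β).div ((h3.norm.pow_const 2).const_mul _)
  refine h1.congr ?_
  filter_upwards [ae_ne_zero_real] with ω hω
  rw [h.spectralDensity_eq heven m β hω, symbol]

theorem integrable_spectralDensity (h : KernelTail K A C) (hI : CondI K) (hII : CondII K)
    {m β : ℝ} (hm : 0 < m) (hβ : 0 < β) : Integrable (spectralDensity m β K) volume := by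
  obtain ⟨M, -, hM⟩ := h.exists_spectralDensity_le hI hII hm hβ
  refine (integrable_inv_one_add_sq.const_mul M).mono'
    (h.aemeasurable_spectralDensity hI.even m β).aestronglyMeasurable ?_
  filter_upwards [ae_ne_zero_real] with ω hω
  rw [Real.norm_eq_abs, abs_of_pos (h.spectralDensity_pos hI hβ hω)]
  exact hM ω hω

end KernelTail

/-! ### Products of bounded integrable functions with mildly singular factors -/

theorem locallyIntegrable_of_forall_intervalIntegrable {f : ℝ → ℝ}
    (hf : ∀ R : ℝ, 0 ≤ R → IntervalIntegrable f volume (-R) R) : LocallyIntegrable f volume := by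
  rw [locallyIntegrable_iff]
  intro k hk
  obtain ⟨R, hR⟩ := hk.isBounded.subset_closedBall 0
  have h1 := hf |R| (abs_nonneg _)
  rw [intervalIntegrable_iff_integrableOn_Icc_of_le (by linarith [abs_nonneg R])] at h1
  refine h1.mono_set (hR.trans ?_)
  rw [Real.closedBall_eq_Icc, zero_sub, zero_add]
  exact Set.Icc_subset_Icc (neg_le_neg (le_abs_self R)) (le_abs_self R)

theorem locallyIntegrable_abs_rpow {r : ℝ} (hr : -1 < r) :
    LocallyIntegrable (fun x : ℝ => |x| ^ r) volume := by
  refine locallyIntegrable_of_forall_intervalIntegrable fun R hR => ?_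
  have h1 : IntervalIntegrable (fun x : ℝ => |x| ^ r) volume 0 R := by
    refine (intervalIntegral.intervalIntegrable_rpow' (a := 0) (b := R) hr).congr fun x hx => ?_
    rw [Set.uIoc_of_le hR] at hx
    simp only [abs_of_pos hx.1]
  have h2 : IntervalIntegrable (fun x : ℝ => |x| ^ r) volume (-R) 0 := by
    have := h1.comp_mul_left (c := -1)
    simpa [div_neg] using this.symm
  exact h2.trans h1

/-- A locally integrable factor that is bounded away from a compact set may multiply any bounded
integrable function. -/
theorem integrable_mul_of_bounded_off_compact {k : ℝ → ℝ} (hk : LocallyIntegrable k volume)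
    {A M : ℝ} (hM : ∀ t, A < |t| → |k t| ≤ M) (hM0 : 0 ≤ M) {χ : ℝ → ℂ}
    (hχ : Integrable χ volume) {B : ℝ} (hB : ∀ t, ‖χ t‖ ≤ B) :
    Integrable (fun t => (k t : ℂ) * χ t) volume := by
  have hB0 : 0 ≤ B := (norm_nonneg _).trans (hB 0)
  set s : Set ℝ := Metric.closedBall 0 A with hs
  have h1 : Integrable (s.indicator fun t => |k t|) volume :=
    IntegrableOn.integrable_indicator
      (Integrable.abs (hk.integrableOn_isCompact (isCompact_closedBall 0 A)))
      measurableSet_closedBall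
  refine ((h1.mul_const B).add (hχ.norm.const_mul M)).mono'
    ((Complex.continuous_ofReal.comp_aestronglyMeasurable hk.aestronglyMeasurable).mul
      hχ.aestronglyMeasurable) (Eventually.of_forall fun t => ?_)
  rw [norm_mul, Complex.norm_real, Real.norm_eq_abs, Pi.add_apply]
  by_cases ht : t ∈ s
  · rw [Set.indicator_of_mem ht]
    have := mul_le_mul_of_nonneg_left (hB t) (abs_nonneg (k t))
    have : 0 ≤ M * ‖χ t‖ := by positivity
    linarith
  · rw [Set.indicator_of_notMem ht, zero_mul, zero_add]
    have : A < |t| := by simpa [hs] using ht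
    gcongr
    exact hM t this

theorem integrable_abs_rpow_mul {r : ℝ} (hr : -1 < r) (hr0 : r ≤ 0) {χ : ℝ → ℂ}
    (hχ : Integrable χ volume) {B : ℝ} (hB : ∀ t, ‖χ t‖ ≤ B) :
    Integrable (fun ω => |ω| ^ r * ‖χ ω‖) volume := by
  have h1 := (integrable_mul_of_bounded_off_compact (locallyIntegrable_abs_rpow hr)
    (A := 1) (M := 1) (fun t ht => ?_) zero_le_one hχ hB).norm
  · refine h1.congr (Eventually.of_forall fun ω => ?_)
    simp only [norm_mul, Complex.norm_real, Real.norm_eq_abs,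
      abs_of_nonneg (Real.rpow_nonneg (abs_nonneg ω) r)]
  · rw [abs_of_nonneg (Real.rpow_nonneg (abs_nonneg t) r)]
    exact Real.rpow_le_one_of_one_le_of_nonpos ht.le hr0

theorem integrable_majorant_mul (D : ℝ) {χ : ℝ → ℂ}
    (hχ : Integrable χ volume) {B : ℝ} (hB : ∀ t, ‖χ t‖ ≤ B) :
    Integrable (fun ω => majorant D ω * ‖χ ω‖) volume := by
  have h1 := integrable_abs_rpow_mul (r := -(1 / 4)) (by norm_num) (by norm_num) hχ hB
  refine ((hχ.norm.add h1).const_mul D).congr (Eventually.of_forall fun ω => ?_)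
  simp only [majorant, Pi.add_apply]
  ring

theorem integrable_majorant_sq_mul (D : ℝ) {χ : ℝ → ℂ}
    (hχ : Integrable χ volume) {B : ℝ} (hB : ∀ t, ‖χ t‖ ≤ B) :
    Integrable (fun ω => majorant D ω ^ 2 * ‖χ ω‖) volume := by
  have h1 := integrable_abs_rpow_mul (r := -(1 / 4)) (by norm_num) (by norm_num) hχ hB
  have h2 := integrable_abs_rpow_mul (r := -(1 / 2)) (by norm_num) (by norm_num) hχ hB
  refine (((hχ.norm.add (h1.const_mul 2)).add h2).const_mul (D ^ 2)).congr
    (Eventually.of_forall fun ω => ?_)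
  have e : (|ω| ^ (-(1 / 4) : ℝ)) ^ 2 = |ω| ^ (-(1 / 2) : ℝ) := by
    rw [← Real.rpow_natCast, ← Real.rpow_mul (abs_nonneg ω)]
    norm_num
  simp only [majorant, Pi.add_apply, ← e]
  ring

/-! ### Fourier calculus on Schwartz functions -/

theorem osc_comm (ω t : ℝ) : osc ω t = osc t ω := by
  rw [osc, osc]; ring_nf

theorem fourierS_eq_osc (φ : 𝓢(ℝ, ℂ)) (ω : ℝ) : fourierS φ ω = ∫ t, osc ω t * φ t :=
  fourierS_apply φ ω

theorem continuous_osc_uncurry : Continuous fun p : ℝ × ℝ => osc p.1 p.2 := by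
  unfold osc; fun_prop

/-- The transform with kernel `e^{-iωt}` is self-adjoint for the bilinear pairing. -/
theorem integral_mul_osc_swap {μ ν : Measure ℝ} [SFinite μ] [SFinite ν] {f g : ℝ → ℂ}
    (hf : Integrable f μ) (hg : Integrable g ν) :
    ∫ t, f t * ∫ ω, osc t ω * g ω ∂ν ∂μ = ∫ ω, (∫ t, osc ω t * f t ∂μ) * g ω ∂ν := by
  simp only [← integral_const_mul, ← integral_mul_const]
  have hint : Integrable (Function.uncurry fun t ω => f t * (osc t ω * g ω)) (μ.prod ν) := by
    have h1 := hf.mul_prod hg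
    refine h1.norm.mono' ?_ (Eventually.of_forall fun p => ?_)
    · have : (Function.uncurry fun t ω => f t * (osc t ω * g ω)) =
          fun p : ℝ × ℝ => osc p.1 p.2 * (f p.1 * g p.2) := by
        ext p; simp only [Function.uncurry]; ring
      rw [this]
      exact continuous_osc_uncurry.aestronglyMeasurable.mul h1.aestronglyMeasurable
    · simp [Function.uncurry]
  rw [integral_integral_swap hint]
  refine integral_congr_ae (Eventually.of_forall fun ω => ?_)
  refine integral_congr_ae (Eventually.of_forall fun t => ?_)
  simp only [osc_comm t ω]
  ring

/-- The pointwise product of Schwartz functions. -/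
def mulS (a b : 𝓢(ℝ, ℂ)) : 𝓢(ℝ, ℂ) := SchwartzMap.smulLeftCLM ℂ a b

@[simp] theorem mulS_apply (a b : 𝓢(ℝ, ℂ)) (x : ℝ) : mulS a b x = a x * b x := by
  simp [mulS, SchwartzMap.smulLeftCLM_apply_apply a.hasTemperateGrowth]

/-- The reflection `x ↦ a (-x)` of a Schwartz function. -/
def reflectS (a : 𝓢(ℝ, ℂ)) : 𝓢(ℝ, ℂ) :=
  SchwartzMap.compCLMOfContinuousLinearEquiv ℂ (ContinuousLinearEquiv.neg ℝ) a

@[simp] theorem reflectS_apply (a : 𝓢(ℝ, ℂ)) (x : ℝ) : reflectS a x = a (-x) := by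
  simp [reflectS]

/-- The complex conjugate of a Schwartz function. -/
def conjS (a : 𝓢(ℝ, ℂ)) : 𝓢(ℝ, ℂ) :=
  SchwartzMap.postcompCLM (𝕜 := ℝ) (Complex.conjCLE : ℂ →L[ℝ] ℂ) a

@[simp] theorem conjS_apply (a : 𝓢(ℝ, ℂ)) (x : ℝ) : conjS a x = conj (a x) := by
  simp [conjS]

theorem fourierS_conjS (a : 𝓢(ℝ, ℂ)) (ω : ℝ) :
    fourierS (conjS a) ω = conj (fourierS a (-ω)) := by
  rw [fourierS_eq_osc, fourierS_eq_osc, ← integral_conj]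
  simp [osc_neg]

theorem fourierS_reflectS (a : 𝓢(ℝ, ℂ)) (ω : ℝ) :
    fourierS (reflectS a) ω = fourierS a (-ω) := by
  rw [fourierS_eq_osc, fourierS_eq_osc, ← integral_neg_eq_self]
  simp [osc_neg, osc_neg']

theorem integral_osc_mul_translate (a : 𝓢(ℝ, ℂ)) (ω u : ℝ) :
    ∫ t, osc ω t * a (t - u) = osc ω u * fourierS a ω := by
  rw [fourierS_eq_osc, ← integral_const_mul,
    ← integral_sub_right_eq_self (fun t => osc ω u * (osc ω t * a t)) u]
  refine integral_congr_ae (Eventually.of_forall fun t => ?_)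
  have : osc ω t = osc ω u * osc ω (t - u) := by rw [← osc_add]; ring_nf
  simp only [this]
  ring

theorem integrable_translate (a : 𝓢(ℝ, ℂ)) (u : ℝ) :
    Integrable (fun t => a (t - u)) volume :=
  a.integrable.comp_sub_right u

/-- Pairing a translate with a transform produces the transform of a product. -/
theorem integral_translate_mul_fourierS (a b : 𝓢(ℝ, ℂ)) (u : ℝ) :
    ∫ t, a (t - u) * fourierS b t = fourierS (mulS (fourierS a) b) u := by
  simp only [fourierS_eq_osc b]
  rw [integral_mul_osc_swap (integrable_translate a u) b.integrable,
    fourierS_eq_osc]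
  refine integral_congr_ae (Eventually.of_forall fun ω => ?_)
  simp only [integral_osc_mul_translate, mulS_apply, osc_comm ω u]
  ring

theorem integral_mul_fourierS (a b : 𝓢(ℝ, ℂ)) :
    ∫ t, a t * fourierS b t = ∫ ω, fourierS a ω * b ω := by
  simp only [fourierS_eq_osc]
  exact integral_mul_osc_swap a.integrable b.integrable

theorem fourierS_eq_fourier (φ : 𝓢(ℝ, ℂ)) (ω : ℝ) :
    fourierS φ ω = (𝓕 φ) (ω * (2 * Real.pi)⁻¹) := by
  simp [fourierS, scale]

/-- Fourier inversion in the normalization `e^{-iωt}`. -/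
theorem fourierS_fourierS (φ : 𝓢(ℝ, ℂ)) (x : ℝ) :
    fourierS (fourierS φ) x = 2 * Real.pi * φ (-x) := by
  have hπ : 0 < 2 * Real.pi := by positivity
  set G : ℝ → ℂ := fun s : ℝ =>
    Complex.exp (((-2 * Real.pi * s * x : ℝ) : ℂ) * Complex.I) • (𝓕 φ) s with hG
  have h1 : ∀ t : ℝ, osc x t * fourierS φ t = G (t * (2 * Real.pi)⁻¹) := by
    intro t
    simp only [hG, fourierS_eq_fourier, smul_eq_mul, osc]
    congr 2
    push_cast
    field_simp
  rw [fourierS_eq_osc, integral_congr_ae (Eventually.of_forall h1),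
    Measure.integral_comp_mul_right]
  rw [inv_inv, abs_of_pos hπ, ← Real.fourier_real_eq_integral_exp_smul]
  have h2 : 𝓕 ((𝓕 φ : 𝓢(ℝ, ℂ)) : ℝ → ℂ) x = φ (-x) := by
    have h3 : (𝓕⁻ (𝓕 φ : 𝓢(ℝ, ℂ))) (-x) = φ (-x) := by rw [FourierTransform.fourierInv_fourier_eq]
    rw [SchwartzMap.fourierInv_coe, Real.fourierInv_eq_fourier_neg, neg_neg] at h3
    exact h3
  rw [h2]
  simp

/-- The inverse of `fourierS`. -/
def fourierInvS (φ : 𝓢(ℝ, ℂ)) : 𝓢(ℝ, ℂ) :=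
  ((2 * Real.pi : ℂ)⁻¹) • reflectS (fourierS φ)

theorem fourierInvS_apply (φ : 𝓢(ℝ, ℂ)) (x : ℝ) :
    fourierInvS φ x = (2 * Real.pi : ℂ)⁻¹ * fourierS φ (-x) := by
  simp [fourierInvS]

theorem fourierS_fourierInvS (φ : 𝓢(ℝ, ℂ)) : fourierS (fourierInvS φ) = φ := by
  ext x
  have hπ : (2 * Real.pi : ℂ) ≠ 0 := by exact_mod_cast (by positivity : 2 * Real.pi ≠ 0)
  have h1 := fourierS_fourierS φ (-x)
  rw [neg_neg, ← fourierS_reflectS, fourierS_eq_osc] at h1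
  rw [fourierS_eq_osc]
  have h2 : ∀ t, osc x t * fourierInvS φ t =
      (2 * Real.pi : ℂ)⁻¹ * (osc x t * reflectS (fourierS φ) t) := by
    intro t; rw [fourierInvS_apply, reflectS_apply]; ring
  simp only [h2]
  rw [integral_const_mul, h1, inv_mul_cancel_left₀ hπ]

theorem fourierS_deriv (φ : 𝓢(ℝ, ℂ)) (ω : ℝ) :
    fourierS (SchwartzMap.derivCLM ℂ ℂ φ) ω = Complex.I * ω * fourierS φ ω := by
  rw [fourierS_eq_fourier, fourierS_eq_fourier]
  have h1 : ((SchwartzMap.derivCLM ℂ ℂ φ : 𝓢(ℝ, ℂ)) : ℝ → ℂ) = deriv φ := by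
    ext t; simp
  have hd : Integrable (deriv φ) volume := by
    rw [← h1]; exact (SchwartzMap.derivCLM ℂ ℂ φ).integrable
  rw [SchwartzMap.fourier_coe, SchwartzMap.fourier_coe, h1,
    Real.fourier_deriv φ.integrable φ.differentiable hd]
  have hπ : (Real.pi : ℂ) ≠ 0 := by exact_mod_cast Real.pi_ne_zero
  simp only [smul_eq_mul]
  push_cast
  field_simp

/-! ### Parseval's formula and convolution for tame kernels -/

/-- A Schwartz function is bounded. -/
theorem norm_schwartz_le (φ : 𝓢(ℝ, ℂ)) (t : ℝ) :
    ‖φ t‖ ≤ SchwartzMap.seminorm ℂ 0 0 φ := φ.norm_le_seminorm ℂ t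

namespace TameKernel

variable {k : ℝ → ℝ} {D : ℝ}

theorem integrable_mul (hk : TameKernel k D) {χ : ℝ → ℂ} (hχ : Integrable χ volume) {B : ℝ}
    (hB : ∀ t, ‖χ t‖ ≤ B) : Integrable (fun t => (k t : ℂ) * χ t) volume := by
  obtain ⟨A, M, hM0, hM⟩ := hk.bounded
  exact integrable_mul_of_bounded_off_compact hk.locallyIntegrable hM hM0 hχ hB

theorem truncFourier_eq_setIntegral (ω : ℝ) {T : ℝ} (hT : 0 ≤ T) :
    truncFourier k ω T = ∫ t in Set.Ioc (-T) T, osc ω t * (k t : ℂ) := by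
  rw [truncFourier, intervalIntegral.integral_of_le (by linarith)]
  rfl

theorem continuous_truncFourier (hk : TameKernel k D) (T : ℝ) :
    Continuous fun ω => truncFourier k ω T := by
  have hi := hk.locallyIntegrable.intervalIntegrable_real (-T) T
  refine intervalIntegral.continuous_of_dominated_interval (bound := fun t => |k t|) ?_ ?_ hi.abs ?_
  · intro ω
    exact (truncFourier_intervalIntegrable hk.locallyIntegrable ω _ T).def'.aestronglyMeasurable
  · intro ω
    filter_upwards with t _
    change ‖osc ω t * (k t : ℂ)‖ ≤ |k t|
    simp
  · filter_upwards with t _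
    exact (osc_continuous_left t).mul continuous_const

theorem aestronglyMeasurable_improperFourier (hk : TameKernel k D) :
    AEStronglyMeasurable (improperFourier k) volume := by
  refine aestronglyMeasurable_of_tendsto_ae atTop (f := fun T ω => truncFourier k ω T)
    (fun T => (hk.continuous_truncFourier T).aestronglyMeasurable) ?_
  filter_upwards [ae_ne_zero_real] with ω hω using hk.tendsto ω hω

theorem norm_improperFourier_le (hk : TameKernel k D) {ω : ℝ} (hω : ω ≠ 0) :
    ‖improperFourier k ω‖ ≤ majorant D ω := by
  refine le_of_tendsto (hk.tendsto ω hω).norm ?_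
  filter_upwards [eventually_ge_atTop 0] with T hT using hk.norm_le ω hω T hT

theorem integrable_improperFourier_mul (hk : TameKernel k D) {χ : ℝ → ℂ}
    (hχ : Integrable χ volume) {B : ℝ} (hB : ∀ t, ‖χ t‖ ≤ B) :
    Integrable (fun ω => improperFourier k ω * χ ω) volume := by
  refine (integrable_majorant_mul D hχ hB).mono'
    (hk.aestronglyMeasurable_improperFourier.mul hχ.aestronglyMeasurable) ?_
  filter_upwards [ae_ne_zero_real] with ω hω
  rw [norm_mul]
  gcongr
  exact hk.norm_improperFourier_le hω

/-- Parseval's formula for a tame kernel against a Schwartz function, by passing to the limit in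
the truncations under the majorant. -/
theorem integral_mul_fourierS (hk : TameKernel k D) (χ : 𝓢(ℝ, ℂ)) :
    ∫ t, (k t : ℂ) * fourierS χ t = ∫ ω, improperFourier k ω * χ ω := by
  have hint := hk.integrable_mul (fourierS χ).integrable
    (norm_schwartz_le (fourierS χ))
  have h1 : Tendsto (fun T : ℝ => ∫ t in (-T)..T, (k t : ℂ) * fourierS χ t) atTop
      (𝓝 (∫ t, (k t : ℂ) * fourierS χ t)) :=
    intervalIntegral_tendsto_integral hint tendsto_neg_atTop_atBot tendsto_id
  have h2 : Tendsto (fun T : ℝ => ∫ ω, truncFourier k ω T * χ ω) atTop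
      (𝓝 (∫ ω, improperFourier k ω * χ ω)) := by
    refine tendsto_integral_filter_of_dominated_convergence
      (fun ω => majorant D ω * ‖χ ω‖) ?_ ?_
      (integrable_majorant_mul D χ.integrable (norm_schwartz_le χ)) ?_
    · exact Eventually.of_forall fun T =>
        ((hk.continuous_truncFourier T).mul χ.continuous).aestronglyMeasurable
    · filter_upwards [eventually_ge_atTop 0] with T hT
      filter_upwards [ae_ne_zero_real] with ω hω
      rw [norm_mul]
      gcongr
      exact hk.norm_le ω hω T hT
    · filter_upwards [ae_ne_zero_real] with ω hω using (hk.tendsto ω hω).mul_const _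
  -- For the truncated, integrable kernel the formula is Fubini.
  refine tendsto_nhds_unique h1 (h2.congr' ?_)
  filter_upwards [eventually_ge_atTop 0] with T hT
  have hkT : Integrable (fun t => (k t : ℂ)) (volume.restrict (Set.Ioc (-T) T)) := by
    have := hk.locallyIntegrable.intervalIntegrable_real (-T) T
    exact this.1.ofReal
  rw [intervalIntegral.integral_of_le (by linarith)]
  simp only [fourierS_eq_osc, truncFourier_eq_setIntegral _ hT]
  exact (integral_mul_osc_swap hkT χ.integrable).symm

/-- The part of the kernel near `0` is integrable and pairs with the bound on `a`; the remaining
part is bounded and pairs with the integrable function `a (t - u) b t`. -/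
theorem integrable_conv_integrand (hk : TameKernel k D) (a b : 𝓢(ℝ, ℂ)) :
    Integrable (fun p : ℝ × ℝ => (k p.2 : ℂ) * a (p.1 - p.2) * b p.1)
      (volume.prod volume) := by
  obtain ⟨A, M, hM0, hM⟩ := hk.bounded
  set s : Set ℝ := Metric.closedBall 0 A with hs
  set B := SchwartzMap.seminorm ℂ 0 0 a
  have h1 : Integrable (s.indicator fun t => |k t|) volume :=
    IntegrableOn.integrable_indicator
      (Integrable.abs (hk.locallyIntegrable.integrableOn_isCompact (isCompact_closedBall 0 A)))
      measurableSet_closedBall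
  have h2 : Integrable (fun p : ℝ × ℝ => ‖b p.1‖ * s.indicator (fun t => |k t|) p.2)
      (volume.prod volume) := b.integrable.norm.mul_prod h1
  have h3 : Integrable (fun p : ℝ × ℝ => b p.1 * a (p.1 - p.2)) (volume.prod volume) := by
    have := (Integrable.convolution_integrand (ContinuousLinearMap.mul ℝ ℂ) b.integrable
      (reflectS a).integrable (μ := volume) (ν := volume)).swap
    refine this.congr (Eventually.of_forall fun p => ?_)
    simp
  refine ((h2.mul_const B).add (h3.norm.const_mul M)).mono' ?_ (Eventually.of_forall fun p => ?_)
  · have hk' : AEStronglyMeasurable (fun p : ℝ × ℝ => (k p.2 : ℂ)) (volume.prod volume) :=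
      (Complex.continuous_ofReal.comp_aestronglyMeasurable
        hk.locallyIntegrable.aestronglyMeasurable).comp_snd
    have ha : Continuous fun p : ℝ × ℝ => a (p.1 - p.2) :=
      a.continuous.comp (continuous_fst.sub continuous_snd)
    exact (hk'.mul ha.aestronglyMeasurable).mul (b.continuous.comp continuous_fst).aestronglyMeasurable
  · have hB := norm_schwartz_le a (p.1 - p.2)
    have hB0 : 0 ≤ B := (norm_nonneg _).trans hB
    simp only [norm_mul, Complex.norm_real, Real.norm_eq_abs, Pi.add_apply]
    by_cases ht : p.2 ∈ s
    · rw [Set.indicator_of_mem ht]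
      have e1 : |k p.2| * ‖a (p.1 - p.2)‖ * ‖b p.1‖ ≤ |k p.2| * B * ‖b p.1‖ := by gcongr
      have e2 : 0 ≤ M * (‖b p.1‖ * ‖a (p.1 - p.2)‖) := by positivity
      linarith
    · rw [Set.indicator_of_notMem ht]
      have : A < |p.2| := by simpa [hs] using ht
      have e1 : |k p.2| * ‖a (p.1 - p.2)‖ * ‖b p.1‖ ≤ M * ‖a (p.1 - p.2)‖ * ‖b p.1‖ := by
        gcongr
        exact hM _ this
      linarith

end TameKernel

theorem conv_apply (f g : ℝ → ℂ) (t : ℝ) : conv f g t = ∫ u, f u * g (t - u) := rfl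

namespace TameKernel

variable {k : ℝ → ℝ} {D : ℝ}

theorem exists_norm_conv_le (hk : TameKernel k D) (a : 𝓢(ℝ, ℂ)) :
    ∃ B, ∀ t, ‖conv (fun u => (k u : ℂ)) a t‖ ≤ B := by
  obtain ⟨A, M, hM0, hM⟩ := hk.bounded
  set s : Set ℝ := Metric.closedBall 0 A with hs
  set B := SchwartzMap.seminorm ℂ 0 0 a
  have h1 : Integrable (s.indicator fun t => |k t|) volume :=
    IntegrableOn.integrable_indicator
      (Integrable.abs (hk.locallyIntegrable.integrableOn_isCompact (isCompact_closedBall 0 A)))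
      measurableSet_closedBall
  refine ⟨(∫ u, s.indicator (fun t => |k t|) u * B) + M * ∫ u, ‖a u‖, fun t => ?_⟩
  have ha : Integrable (fun u => ‖a (t - u)‖) volume := (a.integrable.comp_sub_left t).norm
  have h2 : ∫ u, ‖a (t - u)‖ = ∫ u, ‖a u‖ := integral_sub_left_eq_self (fun u => ‖a u‖) volume t
  rw [← h2, ← integral_const_mul, ← integral_add (h1.mul_const B) (ha.const_mul M), conv_apply]
  refine norm_integral_le_of_norm_le ((h1.mul_const B).add (ha.const_mul M))
    (Eventually.of_forall fun u => ?_)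
  have hB := norm_schwartz_le a (t - u)
  have hB0 : 0 ≤ B := (norm_nonneg _).trans hB
  rw [norm_mul, Complex.norm_real, Real.norm_eq_abs]
  by_cases ht : u ∈ s
  · rw [Set.indicator_of_mem ht]
    have e1 : |k u| * ‖a (t - u)‖ ≤ |k u| * B := by gcongr
    have e2 : 0 ≤ M * ‖a (t - u)‖ := by positivity
    linarith
  · rw [Set.indicator_of_notMem ht, zero_mul, zero_add]
    have : A < |u| := by simpa [hs] using ht
    gcongr
    exact hM _ this

theorem aestronglyMeasurable_conv (hk : TameKernel k D) (a : 𝓢(ℝ, ℂ)) :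
    AEStronglyMeasurable (conv (fun u => (k u : ℂ)) a) volume :=
  (AEStronglyMeasurable.convolution_integrand (ContinuousLinearMap.mul ℝ ℂ)
    (Complex.continuous_ofReal.comp_aestronglyMeasurable
      hk.locallyIntegrable.aestronglyMeasurable)
    a.continuous.aestronglyMeasurable).integral_prod_right'

/-- Fubini's theorem for the pairing of `k * a` with `b`. -/
theorem integral_conv_mul (hk : TameKernel k D) (a b : 𝓢(ℝ, ℂ)) :
    ∫ t, conv (fun u => (k u : ℂ)) a t * b t = ∫ u, (k u : ℂ) * ∫ t, a (t - u) * b t := by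
  simp only [conv_apply, ← integral_mul_const, ← integral_const_mul]
  rw [integral_integral_swap (hk.integrable_conv_integrand a b)]
  simp only [mul_assoc]

end TameKernel

/-! ### Bounded functions as tempered distributions -/

/-- A bounded measurable function is a tempered distribution. -/
theorem exists_isRegular_of_bounded {f : ℝ → ℂ} (hf : AEStronglyMeasurable f volume) {B : ℝ}
    (hB : ∀ t, ‖f t‖ ≤ B) : ∃ g, IsRegular g f := by
  have hmem : MemLp f ⊤ volume := memLp_top_of_bound hf B (Eventually.of_forall hB)
  refine ⟨Lp.toTemperedDistribution hmem.toLp, fun φ => ⟨?_, ?_⟩⟩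
  · exact φ.integrable.bdd_mul hf (Eventually.of_forall hB)
  · rw [Lp.toTemperedDistribution_apply]
    refine integral_congr_ae ?_
    filter_upwards [hmem.coeFn_toLp] with t ht
    rw [ht, smul_eq_mul, mul_comm]

theorem IsRegular.add {g₁ g₂ : 𝓢'(ℝ, ℂ)} {h₁ h₂ : ℝ → ℂ} (H₁ : IsRegular g₁ h₁)
    (H₂ : IsRegular g₂ h₂) : IsRegular (g₁ + g₂) (h₁ + h₂) := by
  intro φ
  have e : (g₁ + g₂) φ = g₁ φ + g₂ φ := rfl
  have e2 : (fun t => (h₁ + h₂) t * φ t) = fun t => h₁ t * φ t + h₂ t * φ t := by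
    ext t; simp [add_mul]
  rw [e, e2, (H₁ φ).2, (H₂ φ).2, integral_add (H₁ φ).1 (H₂ φ).1]
  exact ⟨(H₁ φ).1.add (H₂ φ).1, rfl⟩

theorem IsRegular.smul {g : 𝓢'(ℝ, ℂ)} {h : ℝ → ℂ} (c : ℂ) (H : IsRegular g h) :
    IsRegular (c • g) (c • h) := by
  intro φ
  have e : (c • g) φ = c * g φ := rfl
  have e2 : (fun t => (c • h) t * φ t) = fun t => c * (h t * φ t) := by
    ext t; simp [mul_assoc]
  rw [e, e2, (H φ).2, integral_const_mul]
  exact ⟨(H φ).1.const_mul c, rfl⟩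

theorem IsRegular.eq {g₁ g₂ : 𝓢'(ℝ, ℂ)} {h : ℝ → ℂ} (H₁ : IsRegular g₁ h)
    (H₂ : IsRegular g₂ h) : g₁ = g₂ := by
  ext φ
  rw [(H₁ φ).2, (H₂ φ).2]

/-- The convolution of a tame kernel with a Schwartz function is a tempered distribution whose
Fourier transform is the product of the transforms. -/
theorem TameKernel.exists_isRegular_conv {k : ℝ → ℝ} {D : ℝ} (hk : TameKernel k D)
    (φ : 𝓢(ℝ, ℂ)) : ∃ g, IsRegular g (conv (fun u => (k u : ℂ)) φ) ∧
      FourierIsFun g (fun ω => improperFourier k ω * fourierS φ ω) := by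
  obtain ⟨B, hB⟩ := hk.exists_norm_conv_le φ
  obtain ⟨g, hg⟩ := exists_isRegular_of_bounded (hk.aestronglyMeasurable_conv φ) hB
  refine ⟨g, hg, (hk.integrable_improperFourier_mul (fourierS φ).integrable
    (norm_schwartz_le _)).locallyIntegrable, fun ψ _ => ?_⟩
  rw [(hg _).2, hk.integral_conv_mul]
  simp only [integral_translate_mul_fourierS]
  rw [hk.integral_mul_fourierS]
  simp [mul_assoc]

theorem exists_isRegular_deriv (φ : 𝓢(ℝ, ℂ)) : ∃ g, IsRegular g (deriv φ) ∧
    FourierIsFun g (fun ω => Complex.I * ω * fourierS φ ω) := by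
  have h1 : ((SchwartzMap.derivCLM ℂ ℂ φ : 𝓢(ℝ, ℂ)) : ℝ → ℂ) = deriv φ := by
    ext t; simp
  obtain ⟨g, hg⟩ := exists_isRegular_of_bounded
    (SchwartzMap.derivCLM ℂ ℂ φ).continuous.aestronglyMeasurable (norm_schwartz_le _)
  refine ⟨g, h1 ▸ hg, ?_, fun ψ _ => ?_⟩
  · exact Continuous.locallyIntegrable (by have := (fourierS φ).continuous; fun_prop)
  · rw [(hg _).2, GLE.integral_mul_fourierS]
    simp [fourierS_deriv]

/-! ### The weak form of the Langevin equation in Fourier space -/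

/-- The memory term of the weak form is a convolution with the reflected causal kernel. -/
theorem reflect_KplusConv_reflect (K : ℝ → ℝ) (φ : ℝ → ℂ) :
    reflect (KplusConv K (reflect φ)) = conv (fun u => (Kminus K u : ℂ)) φ := by
  ext t
  rw [reflect, KplusConv, conv_apply, conv_apply, ← integral_neg_eq_self]
  refine integral_congr_ae (Eventually.of_forall fun u => ?_)
  simp only [Kminus, reflect]
  congr 2
  ring

theorem FourierIsFun.congr {g : 𝓢'(ℝ, ℂ)} {f f' : ℝ → ℂ} (h : FourierIsFun g f)
    (hff' : f =ᵐ[volume] f') : FourierIsFun g f' := by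
  refine ⟨h.1.congr hff', fun φ hφ => ?_⟩
  rw [h.2 φ hφ]
  refine integral_congr_ae ?_
  filter_upwards [hff'] with ω hω
  rw [hω]

/-- A real test function, as a complex Schwartz function. -/
theorem exists_schwartz_of_contDiff {χ : ℝ → ℝ} (hχ : ContDiff ℝ (↑(⊤ : ℕ∞)) χ)
    (hc : HasCompactSupport χ) : ∃ a : 𝓢(ℝ, ℂ), HasCompactSupport a ∧ ∀ x, a x = (χ x : ℂ) := by
  have h1 : ContDiff ℝ (↑(⊤ : ℕ∞)) fun x => (χ x : ℂ) := Complex.ofRealCLM.contDiff.comp hχ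
  have h2 : HasCompactSupport fun x => (χ x : ℂ) := hc.comp_left Complex.ofReal_zero
  exact ⟨h2.toSchwartzMap h1, h2, fun x => rfl⟩

/-- The function representing the Fourier transform of a tempered distribution is unique. -/
theorem FourierIsFun.ae_eq {g : 𝓢'(ℝ, ℂ)} {f₁ f₂ : ℝ → ℂ} (h₁ : FourierIsFun g f₁)
    (h₂ : FourierIsFun g f₂) : f₁ =ᵐ[volume] f₂ := by
  refine ae_eq_of_integral_contDiff_smul_eq h₁.1 h₂.1 fun χ hχ hc => ?_
  obtain ⟨a, ha, hax⟩ := exists_schwartz_of_contDiff hχ hc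
  have := (h₁.2 a ha).symm.trans (h₂.2 a ha)
  simpa [hax, mul_comm] using this

namespace KernelTail

variable {K : ℝ → ℝ} {A C D : ℝ}

theorem exists_isRegular_weakTest (h : KernelTail K A C)
    (hD : ∀ ω, ω ≠ 0 → ∀ T, 0 ≤ T → ‖halfTrunc K ω T‖ ≤ majorant D ω) (m β : ℝ)
    (φ : 𝓢(ℝ, ℂ)) : ∃ g, IsRegular g (weakTest m β K φ) ∧
      FourierIsFun g (fun ω => conj (symbol m β K ω) * fourierS φ ω) := by
  obtain ⟨g₁, hg₁, hf₁⟩ := exists_isRegular_deriv φ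
  obtain ⟨g₂, hg₂, hf₂⟩ := (h.tameKernel_Kminus hD).exists_isRegular_conv φ
  refine ⟨(-(m : ℂ)) • g₁ + (β : ℂ) • g₂, ?_, ?_⟩
  · have := (hg₁.smul (-(m : ℂ))).add (hg₂.smul (β : ℂ))
    convert this using 1
    ext t
    rw [weakTest, reflect_KplusConv_reflect]
    rfl
  · refine ((hf₁.smul (-(m : ℂ))).add (hf₂.smul (β : ℂ))).congr ?_
    filter_upwards [ae_ne_zero_real] with ω hω
    simp only [Pi.add_apply, Pi.smul_apply, smul_eq_mul, h.improperFourier_Kminus hω, symbol,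
      map_add, map_mul, Complex.conj_ofReal, Complex.conj_I]
    ring

/-- The covariance of the force in Fourier space. -/
theorem integral_mul_conv_eq (h : KernelTail K A C) (heven : ∀ t, K (-t) = K t)
    (hD : ∀ ω, ω ≠ 0 → ∀ T, 0 ≤ T → ‖halfTrunc K ω T‖ ≤ majorant D ω) (φ ψ : 𝓢(ℝ, ℂ)) :
    ∫ t, (K t : ℂ) * conv φ (fun s => conj (ψ (-s))) t =
      ∫ ω, ((Real.pi⁻¹ * (halfTransform K ω).re : ℝ) : ℂ) *
        (fourierS φ ω * conj (fourierS ψ ω)) := by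
  have h1 : ∀ t, conv φ (fun s => conj (ψ (-s))) t =
      fourierS (mulS (fourierS (conjS ψ)) (fourierInvS φ)) t := by
    intro t
    rw [← integral_translate_mul_fourierS, fourierS_fourierInvS, conv_apply]
    refine integral_congr_ae (Eventually.of_forall fun u => ?_)
    simp [mul_comm]
  simp only [h1]
  rw [(h.tameKernel heven hD).integral_mul_fourierS, ← integral_neg_eq_self]
  refine integral_congr_ae ?_
  filter_upwards [ae_ne_zero_real] with ω hω
  have hπ : (Real.pi : ℂ) ≠ 0 := by exact_mod_cast Real.pi_ne_zero
  rw [h.improperFourier_eq heven (neg_ne_zero.mpr hω), h.halfTransform_neg hω, Complex.conj_re,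
    mulS_apply, fourierS_conjS, fourierInvS_apply, neg_neg]
  push_cast
  field_simp

end KernelTail

theorem StationaryForce.covariance_sqrt {Ω' : Type*} [MeasurableSpace Ω'] {P' : Measure Ω'}
    {K : ℝ → ℝ} (F : StationaryForce P' K) {β : ℝ} (hβ : 0 < β) (φ ψ : 𝓢(ℝ, ℂ)) :
    ∫ ω, ((√β : ℝ) * (F.toLin φ : Ω' → ℂ) ω) * conj ((√β : ℝ) * (F.toLin ψ : Ω' → ℂ) ω) ∂P' =
      β * ∫ t, (K t : ℂ) * conv φ (fun s => conj (ψ (-s))) t := by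
  rw [← F.covariance, ← integral_const_mul]
  refine integral_congr_ae (Eventually.of_forall fun ω => ?_)
  have : ((√β : ℝ) : ℂ) * ((√β : ℝ) : ℂ) = β := by
    rw [← Complex.ofReal_mul, Real.mul_self_sqrt hβ.le]
  simp only [map_mul, Complex.conj_ofReal]
  linear_combination ((F.toLin φ : Ω' → ℂ) ω * conj ((F.toLin ψ : Ω' → ℂ) ω)) * this

/-- The covariance of the scaled force, with density `r̂ |m i ω + β K̂⁺|²`. -/
theorem KernelTail.force_covariance {K : ℝ → ℝ} {A C D : ℝ} (h : KernelTail K A C)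
    (heven : ∀ t, K (-t) = K t)
    (hD : ∀ ω, ω ≠ 0 → ∀ T, 0 ≤ T → ‖halfTrunc K ω T‖ ≤ majorant D ω)
    {Ω' : Type*} [MeasurableSpace Ω'] {P' : Measure Ω'} (F : StationaryForce P' K) {β : ℝ}
    (hβ : 0 < β) (φ ψ : 𝓢(ℝ, ℂ)) :
    ∫ ω, ((√β : ℝ) * (F.toLin φ : Ω' → ℂ) ω) * conj ((√β : ℝ) * (F.toLin ψ : Ω' → ℂ) ω) ∂P' =
      ∫ ω, ((β / Real.pi * (halfTransform K ω).re : ℝ) : ℂ) *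
        (fourierS φ ω * conj (fourierS ψ ω)) := by
  rw [F.covariance_sqrt hβ, h.integral_mul_conv_eq heven hD, ← integral_const_mul]
  refine integral_congr_ae (Eventually.of_forall fun ω => ?_)
  simp only [div_eq_mul_inv]
  push_cast
  ring

/-! ### Sufficiency of the spectral density -/

theorem memLp_two_withDensity_of_integrable {r : ℝ → ℝ} (hr : AEMeasurable r volume)
    (hr0 : ∀ᵐ ω, 0 ≤ r ω) {f : ℝ → ℂ} (hf : AEStronglyMeasurable f volume)
    (hint : Integrable (fun ω => r ω * ‖f ω‖ ^ 2) volume) :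
    MemLp f 2 (volume.withDensity fun ω => ENNReal.ofReal (r ω)) := by
  rw [memLp_two_iff_integrable_sq_norm (hf.mono_ac (withDensity_absolutelyContinuous _ _)),
    integrable_withDensity_iff_integrable_smul₀' hr.ennreal_ofReal
      (Eventually.of_forall fun _ => ENNReal.ofReal_lt_top)]
  refine hint.congr ?_
  filter_upwards [hr0] with ω hω
  rw [ENNReal.toReal_ofReal hω, smul_eq_mul]

namespace KernelTail

variable {K : ℝ → ℝ} {A C D : ℝ}

theorem ae_spectralDensity_nonneg (h : KernelTail K A C) (hI : CondI K) {m β : ℝ} (hβ : 0 < β) :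
    ∀ᵐ ω, 0 ≤ spectralDensity m β K ω := by
  filter_upwards [ae_ne_zero_real] with ω hω using (h.spectralDensity_pos hI hβ hω).le

/-- The square of the majorant is locally integrable and `r̂` is bounded, so `K̂⁺ φ` is square
integrable for the spectral measure. -/
theorem memLp_improperFourier_Kplus_mul (h : KernelTail K A C) (hI : CondI K) (hII : CondII K)
    (hD : ∀ ω, ω ≠ 0 → ∀ T, 0 ≤ T → ‖halfTrunc K ω T‖ ≤ majorant D ω) {m β : ℝ} (hm : 0 < m)
    (hβ : 0 < β) (φ : 𝓢(ℝ, ℂ)) :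
    MemLp (fun ω => improperFourier (Kplus K) ω * φ ω) 2
      (volume.withDensity fun ω => ENNReal.ofReal (spectralDensity m β K ω)) := by
  have hk := h.tameKernel_Kplus hD
  obtain ⟨M, hM0, hM⟩ := h.exists_spectralDensity_le hI hII hm hβ
  have hmeas := h.aemeasurable_spectralDensity hI.even m β
  have hf : AEStronglyMeasurable (fun ω => improperFourier (Kplus K) ω * φ ω) volume :=
    hk.aestronglyMeasurable_improperFourier.mul φ.continuous.aestronglyMeasurable
  refine memLp_two_withDensity_of_integrable hmeas (h.ae_spectralDensity_nonneg hI hβ) hf ?_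
  refine ((integrable_majorant_sq_mul D (mulS φ φ).integrable
    (norm_schwartz_le _)).const_mul M).mono'
    (hmeas.aestronglyMeasurable.mul (hf.norm.pow 2)) ?_
  filter_upwards [ae_ne_zero_real] with ω hω
  have h1 : spectralDensity m β K ω ≤ M := by
    refine (hM ω hω).trans (mul_le_of_le_one_right hM0.le ?_)
    exact inv_le_one_of_one_le₀ (by nlinarith [sq_nonneg ω])
  have h2 := hk.norm_improperFourier_le hω
  have h3 := (h.spectralDensity_pos hI (m := m) hβ hω).le
  rw [Real.norm_eq_abs, abs_of_nonneg (by positivity), mulS_apply, norm_mul, norm_mul]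
  have h4 : ‖improperFourier (Kplus K) ω‖ ^ 2 ≤ majorant D ω ^ 2 := by gcongr
  calc spectralDensity m β K ω * (‖improperFourier (Kplus K) ω‖ * ‖φ ω‖) ^ 2
      = spectralDensity m β K ω * (‖improperFourier (Kplus K) ω‖ ^ 2 * (‖φ ω‖ * ‖φ ω‖)) := by ring
    _ ≤ M * (majorant D ω ^ 2 * (‖φ ω‖ * ‖φ ω‖)) := by gcongr

theorem integrable_re_mul (h : KernelTail K A C)
    (hD : ∀ ω, ω ≠ 0 → ∀ T, 0 ≤ T → ‖halfTrunc K ω T‖ ≤ majorant D ω) (φ : 𝓢(ℝ, ℂ)) :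
    Integrable (fun ω => (halfTransform K ω).re * ‖φ ω‖) volume := by
  refine (integrable_majorant_mul D φ.integrable (norm_schwartz_le φ)).mono'
    ((Complex.continuous_re.comp_aestronglyMeasurable h.aestronglyMeasurable_halfTransform).mul
      φ.continuous.norm.aestronglyMeasurable) ?_
  filter_upwards [ae_ne_zero_real] with ω hω
  rw [norm_mul, norm_norm, Real.norm_eq_abs]
  gcongr
  exact (Complex.abs_re_le_norm _).trans (h.norm_halfTransform_le hD hω)

theorem memLp_conj_symbol_mul (h : KernelTail K A C) (hI : CondI K)
    (hD : ∀ ω, ω ≠ 0 → ∀ T, 0 ≤ T → ‖halfTrunc K ω T‖ ≤ majorant D ω) {m β : ℝ}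
    (hβ : 0 < β) (φ : 𝓢(ℝ, ℂ)) :
    MemLp (fun ω => conj (symbol m β K ω) * φ ω) 2
      (volume.withDensity fun ω => ENNReal.ofReal (spectralDensity m β K ω)) := by
  have hf : AEStronglyMeasurable (fun ω => conj (symbol m β K ω) * φ ω) volume :=
    (Complex.continuous_conj.comp_aestronglyMeasurable (h.aestronglyMeasurable_symbol m β)).mul
      φ.continuous.aestronglyMeasurable
  refine memLp_two_withDensity_of_integrable (h.aemeasurable_spectralDensity hI.even m β)
    (h.ae_spectralDensity_nonneg hI hβ) hf ?_
  refine ((h.integrable_re_mul hD (mulS φ φ)).const_mul (β / Real.pi)).congr ?_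
  filter_upwards [ae_ne_zero_real] with ω hω
  rw [← mul_assoc, ← h.spectralDensity_mul_norm_symbol_sq hI (m := m) hβ hω, mulS_apply, norm_mul,
    norm_mul, RCLike.norm_conj]
  ring

/-- The operator with spectral density `r̂` is a weak solution: both sides of the weak equation are
the integral of `r̂ |p|² φ̂ conj ψ̂`. -/
theorem isWeakSolution_of_eq (h : KernelTail K A C) (hI : CondI K) (hII : CondII K)
    (hD : ∀ ω, ω ≠ 0 → ∀ T, 0 ≤ T → ‖halfTrunc K ω T‖ ≤ majorant D ω) {m β : ℝ} (hm : 0 < m)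
    (hβ : 0 < β) {Ω Ω' : Type*} [MeasurableSpace Ω] [MeasurableSpace Ω'] {P : Measure Ω}
    {P' : Measure Ω'} {ν : Measure ℝ} (V : SpectralOperator P ν) (F : StationaryForce P' K)
    (hν : ν = volume.withDensity fun ω => ENNReal.ofReal (spectralDensity m β K ω)) :
    IsWeakSolution m β V F := by
  refine ⟨fun φ => ?_, fun φ ψ => ?_⟩
  · obtain ⟨g, hg, hf⟩ := (h.tameKernel_Kplus hD).exists_isRegular_conv φ
    refine ⟨⟨g, _, hf, ?_⟩, hg⟩
    rw [hν]
    exact h.memLp_improperFourier_Kplus_mul hI hII hD hm hβ _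
  · obtain ⟨g₁, hg₁, hf₁⟩ := h.exists_isRegular_weakTest hD m β φ
    obtain ⟨g₂, hg₂, hf₂⟩ := h.exists_isRegular_weakTest hD m β ψ
    have hmem : ∀ χ : 𝓢(ℝ, ℂ), MemLp (fun ω => conj (symbol m β K ω) * χ ω) 2 ν := fun χ => by
      rw [hν]; exact h.memLp_conj_symbol_mul hI hD hβ χ
    refine ⟨⟨g₁, _, hf₁, hmem _⟩, ⟨g₂, _, hf₂, hmem _⟩, hg₁, hg₂, ?_⟩
    rw [V.covariance _ _ _ _ hf₁ hf₂, h.force_covariance hI.even hD F hβ, hν,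
      integral_withDensity_eq_integral_toReal_smul₀
        (h.aemeasurable_spectralDensity hI.even m β).ennreal_ofReal
        (Eventually.of_forall fun _ => ENNReal.ofReal_lt_top)]
    refine integral_congr_ae ?_
    filter_upwards [ae_ne_zero_real] with ω hω
    rw [ENNReal.toReal_ofReal (h.spectralDensity_pos hI hβ hω).le, Complex.real_smul,
      ← h.spectralDensity_mul_norm_symbol_sq hI (m := m) hβ hω, map_mul, Complex.conj_conj]
    push_cast
    rw [← Complex.conj_mul']
    ring

end KernelTail

/-! ### Necessity of the spectral density -/

theorem IsTempered.isLocallyFiniteMeasure {ν : Measure ℝ} (hν : IsTempered ν) :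
    IsLocallyFiniteMeasure ν := by
  obtain ⟨k, hk⟩ := hν
  refine ⟨fun x => ⟨Metric.closedBall x 1, Metric.closedBall_mem_nhds x one_pos, ?_⟩⟩
  set c : ℝ := ((1 + (|x| + 1) ^ 2) ^ k)⁻¹ with hc
  have hc0 : 0 < c := by positivity
  have h1 : ENNReal.ofReal c * ν (Metric.closedBall x 1) < ⊤ := by
    refine lt_of_le_of_lt ?_ hk
    rw [← setLIntegral_const]
    refine (setLIntegral_mono_ae' measurableSet_closedBall
      (Eventually.of_forall fun y hy => ?_)).trans
      (setLIntegral_le_lintegral _ _)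
    refine ENNReal.ofReal_le_ofReal ?_
    have hy' : |y| ≤ |x| + 1 := by
      rw [Metric.mem_closedBall, Real.dist_eq] at hy
      have := abs_sub_abs_le_abs_sub y x
      linarith
    have : y ^ 2 ≤ (|x| + 1) ^ 2 := by rw [← sq_abs y]; gcongr
    rw [hc]
    gcongr
  by_contra htop
  rw [not_lt, top_le_iff] at htop
  rw [htop, ENNReal.mul_top (by simpa using hc0)] at h1
  exact lt_irrefl _ h1

/-- Schwartz plateau functions. -/
theorem exists_schwartz_eq_one (R : ℝ) : ∃ b : 𝓢(ℝ, ℂ), ∀ x, |x| ≤ R → b x = 1 := by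
  let f : ContDiffBump (0 : ℝ) := ⟨|R| + 1, |R| + 2, by positivity, by linarith⟩
  obtain ⟨b, -, hb⟩ := exists_schwartz_of_contDiff f.contDiff f.hasCompactSupport
  refine ⟨b, fun x hx => ?_⟩
  rw [hb, f.one_of_mem_closedBall]
  · simp
  · rw [mem_closedBall_zero_iff, Real.norm_eq_abs]
    change |x| ≤ |R| + 1
    linarith [le_abs_self R]

/-- Plateau functions turn global integrability against squared Schwartz functions into local
integrability. -/
theorem locallyIntegrable_of_forall_schwartz {f : ℝ → ℝ}
    (hf : ∀ b : 𝓢(ℝ, ℂ), Integrable (fun ω => f ω * ‖b ω‖ ^ 2) volume) :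
    LocallyIntegrable f volume := by
  refine locallyIntegrable_of_forall_intervalIntegrable fun R hR => ?_
  obtain ⟨b, hb⟩ := exists_schwartz_eq_one R
  rw [intervalIntegrable_iff_integrableOn_Icc_of_le (by linarith)]
  refine (hf b).integrableOn.congr_fun (fun x hx => ?_) measurableSet_Icc
  simp [hb x (abs_le.mpr hx)]

/-- Two locally integrable densities that pair equally with all products `a b̄` of Schwartz
functions are equal: a test function is its own product with a plateau function. -/
theorem ae_eq_of_forall_integral_mul_conj_eq {f₁ f₂ : ℝ → ℝ} (h₁ : LocallyIntegrable f₁ volume)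
    (h₂ : LocallyIntegrable f₂ volume)
    (h : ∀ a b : 𝓢(ℝ, ℂ), ∫ ω, (f₁ ω : ℂ) * (a ω * conj (b ω)) =
      ∫ ω, (f₂ ω : ℂ) * (a ω * conj (b ω))) : f₁ =ᵐ[volume] f₂ := by
  refine ae_eq_of_integral_contDiff_smul_eq h₁ h₂ fun χ hχ hc => ?_
  obtain ⟨a, -, hax⟩ := exists_schwartz_of_contDiff hχ hc
  obtain ⟨R, hR⟩ := hc.isCompact.isBounded.subset_closedBall 0
  obtain ⟨b, hb⟩ := exists_schwartz_eq_one R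
  have hab : ∀ ω, a ω * conj (b ω) = (χ ω : ℂ) := by
    intro ω
    by_cases hω : ω ∈ tsupport χ
    · rw [hax, hb ω (by simpa using hR hω)]; simp
    · rw [hax, image_eq_zero_of_notMem_tsupport hω]; simp
  have h3 := h a b
  simp only [hab, ← Complex.ofReal_mul] at h3
  rw [integral_complex_ofReal, integral_complex_ofReal] at h3
  simpa [mul_comm] using h3

/-- The weak equation determines the spectral measure: writing `ν = ρ dω`, it forces
`ρ |p|² = r̂ |p|²` almost everywhere. -/
theorem KernelTail.eq_of_isWeakSolution {K : ℝ → ℝ} {A C D : ℝ} (h : KernelTail K A C)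
    (hI : CondI K)
    (hD : ∀ ω, ω ≠ 0 → ∀ T, 0 ≤ T → ‖halfTrunc K ω T‖ ≤ majorant D ω) {m β : ℝ}
    (hβ : 0 < β) {Ω Ω' : Type*} [MeasurableSpace Ω] [MeasurableSpace Ω'] {P : Measure Ω}
    {P' : Measure Ω'} {ν : Measure ℝ} (hν : IsTempered ν) (hac : ν ≪ volume)
    (V : SpectralOperator P ν) (F : StationaryForce P' K) (hV : IsWeakSolution m β V F) :
    ν = volume.withDensity fun ω => ENNReal.ofReal (spectralDensity m β K ω) := by
  have := hν.isLocallyFiniteMeasure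
  set ρ := ν.rnDeriv volume with hρ
  have hρν : volume.withDensity ρ = ν := Measure.withDensity_rnDeriv_eq ν volume hac
  have hρm : Measurable ρ := Measure.measurable_rnDeriv ν volume
  have hρt : ∀ᵐ ω ∂(volume : Measure ℝ), ρ ω < ⊤ := Measure.rnDeriv_lt_top ν volume
  have hsurj : ∀ a : 𝓢(ℝ, ℂ), ∃ φ, fourierS φ = a := fun a => ⟨_, fourierS_fourierInvS a⟩
  have hfun : ∀ (φ : 𝓢(ℝ, ℂ)) (g : Dom ν), IsRegular g (weakTest m β K φ) →
      FourierIsFun g (fun ω => conj (symbol m β K ω) * fourierS φ ω) := by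
    intro φ g hg
    obtain ⟨g', hg', hf'⟩ := h.exists_isRegular_weakTest hD m β φ
    rwa [hg.eq hg']
  -- The tested functions lie in the domain of `V`, so `conj p · φ̂` is in `L²(ν)` for all `φ`. The
  -- representative provided by the domain agrees with it Lebesgue-a.e., hence `ν`-a.e.
  have hloc₁ : LocallyIntegrable (fun ω => (ρ ω).toReal * ‖symbol m β K ω‖ ^ 2) volume := by
    refine locallyIntegrable_of_forall_schwartz fun b => ?_
    obtain ⟨φ, rfl⟩ := hsurj b
    obtain ⟨g, -, hg, -, -⟩ := hV.2 φ φ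
    obtain ⟨f, hf, hmem⟩ := g.2
    have hmem' := hmem.ae_eq (hac.ae_le (hf.ae_eq (hfun φ g hg)))
    have h1 := hmem'.integrable_norm_pow two_ne_zero
    rw [← hρν, integrable_withDensity_iff_integrable_smul' hρm hρt] at h1
    refine h1.congr (Eventually.of_forall fun ω => ?_)
    simp only [norm_mul, RCLike.norm_conj, smul_eq_mul]
    ring
  have hloc₂ : LocallyIntegrable (fun ω => β / Real.pi * (halfTransform K ω).re) volume := by
    refine locallyIntegrable_of_forall_schwartz fun b => ?_
    refine ((h.integrable_re_mul hD (mulS b b)).const_mul (β / Real.pi)).congr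
      (Eventually.of_forall fun ω => ?_)
    simp only [mulS_apply, norm_mul]
    ring
  have hae := ae_eq_of_forall_integral_mul_conj_eq hloc₁ hloc₂ fun a b => by
    obtain ⟨φ, rfl⟩ := hsurj a
    obtain ⟨ψ, rfl⟩ := hsurj b
    obtain ⟨g₁, g₂, hg₁, hg₂, hcov⟩ := hV.2 φ ψ
    rw [V.covariance _ _ _ _ (hfun φ g₁ hg₁) (hfun ψ g₂ hg₂),
      h.force_covariance hI.even hD F hβ] at hcov
    rw [← hcov, ← hρν, integral_withDensity_eq_integral_toReal_smul hρm hρt]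
    refine integral_congr_ae (Eventually.of_forall fun ω => ?_)
    simp only [Complex.real_smul, map_mul, Complex.conj_conj]
    push_cast
    rw [← Complex.conj_mul']
    ring
  rw [← hρν]
  refine withDensity_congr_ae ?_
  filter_upwards [hae, hρt, ae_ne_zero_real] with ω hω hωt hω0
  rw [← h.spectralDensity_mul_norm_symbol_sq hI (m := m) hβ hω0] at hω
  have h1 := h.norm_symbol_pos hI (m := m) hβ hω0
  rw [← mul_right_cancel₀ (pow_pos h1 2).ne' hω, ENNReal.ofReal_toReal hωt.ne]

end GLE

end

theorem mainTheorem2 {K : ℝ → ℝ} {m β : ℝ} (hm : 0 < m) (hβ : 0 < β)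
    (hI : GLE.CondI K) (hII : GLE.CondII K) :
    (∀ ω : ℝ, ω ≠ 0 →
      Tendsto (GLE.truncFourier K ω) atTop (𝓝 (GLE.improperFourier K ω)) ∧
      Tendsto (GLE.truncFourier (GLE.Kplus K) ω) atTop
        (𝓝 (GLE.improperFourier (GLE.Kplus K) ω))) ∧
    Integrable (GLE.spectralDensity m β K) volume ∧
    ∀ {Ω Ω' : Type*} [MeasurableSpace Ω] [MeasurableSpace Ω'] (P : Measure Ω) (P' : Measure Ω')
      [IsProbabilityMeasure P] [IsProbabilityMeasure P'] (ν : Measure ℝ),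
      GLE.IsTempered ν → ν ≪ volume →
      ∀ (V : GLE.SpectralOperator P ν) (F : GLE.StationaryForce P' K),
        GLE.IsWeakSolution m β V F ↔
          ν = volume.withDensity (fun ω => ENNReal.ofReal (GLE.spectralDensity m β K ω)) := by
  obtain ⟨A, C, h⟩ := hI.exists_kernelTail hII
  obtain ⟨D, -, hD⟩ := h.exists_norm_halfTrunc_le
  refine ⟨fun ω hω => ⟨(h.tameKernel hI.even hD).tendsto ω hω,
    (h.tameKernel_Kplus hD).tendsto ω hω⟩, h.integrable_spectralDensity hI hII hm hβ, ?_⟩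
  intro Ω Ω' _ _ P P' _ _ ν hν hac V F
  exact ⟨h.eq_of_isWeakSolution hI hD hβ hν hac V F,
    h.isWeakSolution_of_eq hI hII hD hm hβ V F⟩
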